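/- Let $K$ be an algebraically closed field, $Q$ a finite quiver with vertices $e_1,\dots,e_n$, $I$ an admissible ideal of the path algebra $KQ$, and $\Lambda = KQ/I$; assume that the Jacobson radical $J$ of $\Lambda$ satisfies $J^2=0$. (Up to isomorphism, these are the basic finite dimensional $K$-algebras with $J^2=0$.) Modules are finite dimensional left $\Lambda$-modules. The top of a module $M$ is $\operatorname{top} M = M/JM$, its dimension vector is $(\dim_K e_iM)_{i}$, and isomorphic semisimple modules are identified. For a dimension vector $\mathbf d=(d_1,\dots,d_n)$, let $\mathbf{Rep}_{\mathbf d}(\Lambda)$ be the affine variety of all families $(x_\alpha)\in\prod_{\alpha}\operatorname{Hom}_K(K^{d_{\mathrm{start}(\alpha)}},K^{d_{\mathrm{end}(\alpha)}})$, indexed by the arrows $\alpha$ of $Q$, which satisfy all relations in $I$, with the conjugation action of $\mathrm{GL}(\mathbf d)=\prod_i \mathrm{GL}_{d_i}(K)$; its orbits correspond to the isomorphism classes of modules with dimension vector $\mathbf d$. A module is said to be in a subset of $\mathbf{Rep}_{\mathbf d}(\Lambda)$ if it is isomorphic to the module given by a point of the subset. A module $X$ is a degeneration of a module $M$ with the same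 dimension vector $\mathbf d$ if $X$ is in the Zariski closure of the $\mathrm{GL}(\mathbf d)$-orbit of $M$. For a semisimple module $T$, let $\mathbf{Rep}^T_{\mathbf d}$ be the set of the points of $\mathbf{Rep}_{\mathbf d}(\Lambda)$ whose modules have top $T$, and let $\overline{\mathbf{Rep}^T_{\mathbf d}}$ be its Zariski closure in $\mathbf{Rep}_{\mathbf d}(\Lambda)$; $T$ is realizable with respect to $\mathbf d$ if $\mathbf{Rep}^T_{\mathbf d}\neq\varnothing$. **Proposition 4.1 and Corollary 4.2.** Let $T$ be a semisimple module which is realizable with respect to $\mathbf d$. (a) Every module in $\overline{\mathbf{Rep}^T_{\mathbf d}}$ is a degeneration of some module in $\mathbf{Rep}^T_{\mathbf d}$. (b) Let $X$ be a module with dimension vector $\mathbf d$ such that $T\subsetneqq\operatorname{top}X$. Then the following are equivalent: $X$ is a degeneration of some module in $\mathbf{Rep}^T_{\mathbf d}$; $X$ is in $\overline{\mathbf{Rep}^T_{\mathbf d}}$; $X\cong X'\oplus U$, where $X'$ has top $T$ and $U$ is a nonzero semisimple module. (c) The modules in $\overline{\mathbf{Rep}^T_{\mathbf d}}$ are precisely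 the modules with dimension vector $\mathbf d$ which have the form $M\oplus U$, where $M$ has top $T$ and $U$ is semisimple (possibly zero). -/

import Mathlib

open Module

universe u v w x y

noncomputable section

namespace QuiverRep

/-! ## The path algebra of a quiver -/

section PathAlgebra

variable (K : Type u) [Field K] (V : Type v) [Fintype V] [Quiver.{w} V]

/-- The generators of the path algebra: the vertices and the arrows of the quiver. -/
abbrev Gen : Type (max v w) := V ⊕ (Σ a : V, Σ b : V, (a ⟶ b))

/-- The defining relations of the path algebra. Products are written like compositions of maps:
`β * α` means "first `α`, then `β`". -/
inductive PathRel : FreeAlgebra K (Gen V) → FreeAlgebra K (Gen V) → Prop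
  | idem (i : V) :
      PathRel (FreeAlgebra.ι K (Sum.inl i) * FreeAlgebra.ι K (Sum.inl i))
        (FreeAlgebra.ι K (Sum.inl i))
  | orth (i j : V) (h : i ≠ j) :
      PathRel (FreeAlgebra.ι K (Sum.inl i) * FreeAlgebra.ι K (Sum.inl j)) 0
  | one : PathRel (∑ i : V, FreeAlgebra.ι K (Sum.inl i)) 1
  | target {a b : V} (α : a ⟶ b) :
      PathRel (FreeAlgebra.ι K (Sum.inl b) * FreeAlgebra.ι K (Sum.inr ⟨a, b, α⟩))
        (FreeAlgebra.ι K (Sum.inr ⟨a, b, α⟩))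
  | source {a b : V} (α : a ⟶ b) :
      PathRel (FreeAlgebra.ι K (Sum.inr ⟨a, b, α⟩) * FreeAlgebra.ι K (Sum.inl a))
        (FreeAlgebra.ι K (Sum.inr ⟨a, b, α⟩))

/-- The path algebra `KQ` of the quiver `Q` with finite vertex set `V`. -/
abbrev PathAlgebra : Type (max u v w) := RingQuot (PathRel K V)

variable {V}

/-- The idempotent (path of length zero) at the vertex `i`. -/
def vertex (i : V) : PathAlgebra K V :=
  RingQuot.mkAlgHom K (PathRel K V) (FreeAlgebra.ι K (Sum.inl i))

/-- The element of the path algebra given by an arrow. -/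
def arrow {a b : V} (α : a ⟶ b) : PathAlgebra K V :=
  RingQuot.mkAlgHom K (PathRel K V) (FreeAlgebra.ι K (Sum.inr ⟨a, b, α⟩))

/-- The element of the path algebra given by a path. -/
def ofPath {a : V} : {b : V} → Quiver.Path a b → PathAlgebra K V
  | _, Quiver.Path.nil => vertex K a
  | _, Quiver.Path.cons p α => arrow K α * ofPath p

variable (V) in
/-- The `m`-th power of the arrow ideal: the subspace of the path algebra which is spanned
by the paths of length at least `m`. -/
def arrowIdealPow (m : ℕ) : Submodule K (PathAlgebra K V) :=
  Submodule.span K {z | ∃ (a b : V) (p : Quiver.Path a b), m ≤ p.length ∧ z = ofPath K p}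

variable {K}

/-- An ideal `I` of the path algebra is admissible if it is contained in the square
of the arrow ideal and contains some power of the arrow ideal. -/
def IsAdmissible (I : Ideal (PathAlgebra K V)) : Prop :=
  I.restrictScalars K ≤ arrowIdealPow K V 2 ∧
    ∃ m : ℕ, arrowIdealPow K V m ≤ I.restrictScalars K

end PathAlgebra

/-! ## Modules: tops and dimension vectors -/

/-- The top `X / J X` of a left module, where `J` is the Jacobson radical of the ring. -/
abbrev ModTop (Λ : Type u) [Ring Λ] (X : Type v) [AddCommGroup X] [Module Λ X] : Type v :=
  X ⧸ (Ring.jacobson Λ • (⊤ : Submodule Λ X))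

/-- The modules `X` and `Y` agree up to isomorphism. -/
abbrev ModIso (Λ : Type u) [Ring Λ] (X : Type v) [AddCommGroup X] [Module Λ X]
    (Y : Type w) [AddCommGroup Y] [Module Λ Y] : Prop :=
  Nonempty (X ≃ₗ[Λ] Y)

/-- `T` is, up to isomorphism, a proper submodule of `Y`. -/
def ProperlyEmbeds (Λ : Type u) [Ring Λ] (T : Type v) [AddCommGroup T] [Module Λ T]
    (Y : Type w) [AddCommGroup Y] [Module Λ Y] : Prop :=
  ∃ f : T →ₗ[Λ] Y, Function.Injective f ∧ ¬ Function.Surjective f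

section Rep

variable {K : Type u} [Field K] {V : Type v} [Fintype V] [Quiver.{w} V]

/-- The `KQ/I`-module `X` has dimension vector `d`, that is, `dim e_i X = d_i` for every
vertex `i`. -/
def HasDimVector (I : Ideal (PathAlgebra K V)) [I.IsTwoSided] (d : V → ℕ)
    (X : Type x) [AddCommGroup X] [Module K X] [Module (PathAlgebra K V ⧸ I) X]
    [IsScalarTower K (PathAlgebra K V ⧸ I) X] : Prop :=
  FiniteDimensional K X ∧
    ∀ i : V, finrank K (LinearMap.range
      (Algebra.lsmul K K X (Ideal.Quotient.mk I (vertex K i)))) = d i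

/-! ## The variety of representations -/

/-- The affine space `∏_α Hom(K^{d_start(α)}, K^{d_end(α)})`, with linear maps written as
matrices. -/
abbrev RepSpace (K : Type u) [Field K] {V : Type v} [Quiver.{w} V] (d : V → ℕ) :
    Type (max u v w) :=
  ∀ ⦃a b : V⦄, (a ⟶ b) → Matrix (Fin (d b)) (Fin (d a)) K

variable [DecidableEq V]

/-- The action of the generators of the path algebra on `⨁_i K^{d_i}` for a family of matrices:
a vertex acts as the projection onto its summand, an arrow `α : a ⟶ b` as the matrix `x α` from
the summand at `a` to the summand at `b`. -/
def genAction {d : V → ℕ} (z : RepSpace K d) : Gen V → Module.End K (∀ i : V, Fin (d i) → K)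
  | Sum.inl i => LinearMap.single K (fun j : V => Fin (d j) → K) i ∘ₗ LinearMap.proj i
  | Sum.inr ⟨a, b, α⟩ =>
      LinearMap.single K (fun j : V => Fin (d j) → K) b ∘ₗ Matrix.toLin' (z α) ∘ₗ
        LinearMap.proj a

/-- The action of the whole path algebra on `⨁_i K^{d_i}` for a family of matrices. -/
def pathAction {d : V → ℕ} (z : RepSpace K d) :
    PathAlgebra K V →ₐ[K] Module.End K (∀ i : V, Fin (d i) → K) :=
  RingQuot.liftAlgHom K ⟨FreeAlgebra.lift K (genAction z), by
    intro p q h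
    induction h with
    | idem i =>
      refine LinearMap.ext fun m => ?_
      simp [genAction]
    | orth i j h =>
      refine LinearMap.ext fun m => ?_
      simp [genAction, Pi.single_eq_of_ne h]
    | one =>
      refine LinearMap.ext fun m => ?_
      simp [genAction, Finset.univ_sum_single]
    | target α =>
      refine LinearMap.ext fun m => ?_
      simp [genAction]
    | source α =>
      refine LinearMap.ext fun m => ?_
      simp [genAction]⟩

/-- `Rep_d(KQ/I)`: the families of matrices which satisfy all relations in `I`. -/
def Rep (I : Ideal (PathAlgebra K V)) (d : V → ℕ) : Set (RepSpace K d) :=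
  {z | ∀ r ∈ I, pathAction z r = 0}

/-- The coordinates on the affine space of families of matrices. -/
abbrev Coord (d : V → ℕ) : Type (max v w) :=
  Σ a : V, Σ b : V, Σ _ : (a ⟶ b), Fin (d b) × Fin (d a)

/-- The coordinate vector of a family of matrices. -/
def coords {d : V → ℕ} (z : RepSpace K d) : Coord d → K :=
  fun c => z c.2.2.1 c.2.2.2.1 c.2.2.2.2

/-- The Zariski closure, in `Rep_d(KQ/I)`, of a set of points. -/
def zariskiClosure {I : Ideal (PathAlgebra K V)} {d : V → ℕ} (S : Set (Rep I d)) :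
    Set (Rep I d) :=
  {z | ∀ f : MvPolynomial (Coord d) K,
    (∀ s ∈ S, MvPolynomial.eval (coords (s : RepSpace K d)) f = 0) →
      MvPolynomial.eval (coords (z : RepSpace K d)) f = 0}

/-- The orbit of a point under the conjugation action of `GL(d) = ∏_i GL_{d_i}(K)`. -/
def glOrbit {I : Ideal (PathAlgebra K V)} {d : V → ℕ} (m : Rep I d) : Set (Rep I d) :=
  {z | ∃ g : ∀ i : V, (Matrix (Fin (d i)) (Fin (d i)) K)ˣ, ∀ ⦃a b : V⦄ (α : a ⟶ b),
    (z : RepSpace K d) α = (g b).val * (m : RepSpace K d) α * ((g a)⁻¹).val}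

variable {I : Ideal (PathAlgebra K V)} {d : V → ℕ}

/-- The module `M(z)` given by a point `z` of `Rep_d(KQ/I)`: the space `⨁_i K^{d_i}` on which
the arrows act through the matrices of `z`. -/
def RepModule (_z : Rep I d) : Type (max u v) := ∀ i : V, Fin (d i) → K

instance (z : Rep I d) : AddCommGroup (RepModule z) :=
  inferInstanceAs (AddCommGroup (∀ i : V, Fin (d i) → K))

instance [I.IsTwoSided] (z : Rep I d) : Module (PathAlgebra K V ⧸ I) (RepModule z) :=
  letI : Module (Module.End K (∀ i : V, Fin (d i) → K)) (RepModule z) :=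
    inferInstanceAs (Module (Module.End K (∀ i : V, Fin (d i) → K)) (∀ i : V, Fin (d i) → K))
  Module.compHom (RepModule z)
    (Ideal.Quotient.lift I (pathAction (z : RepSpace K d)).toRingHom z.2)

variable [I.IsTwoSided]

/-- `X` is one of the modules "in" the set `S` of points of `Rep_d(KQ/I)`. -/
def IsModuleIn (S : Set (Rep I d)) (X : Type x) [AddCommGroup X]
    [Module (PathAlgebra K V ⧸ I) X] : Prop :=
  ∃ z ∈ S, ModIso (PathAlgebra K V ⧸ I) X (RepModule z)

variable (I) in
/-- `X` is a degeneration of `M`: for some dimension vector `d`, both are given by points of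
`Rep_d(KQ/I)`, and the point of `X` is in the Zariski closure of the orbit of the point of `M`. -/
def IsDegeneration (X : Type x) [AddCommGroup X] [Module (PathAlgebra K V ⧸ I) X]
    (M : Type y) [AddCommGroup M] [Module (PathAlgebra K V ⧸ I) M] : Prop :=
  ∃ (d : V → ℕ) (m : Rep I d), ModIso (PathAlgebra K V ⧸ I) M (RepModule m) ∧
    IsModuleIn (zariskiClosure (glOrbit m)) X

variable (I d) in
/-- `Rep_d^T`: the points of `Rep_d(KQ/I)` whose modules have top `T`. -/
def RepTop (T : Type x) [AddCommGroup T] [Module (PathAlgebra K V ⧸ I) T] : Set (Rep I d) :=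
  {z | ModIso (PathAlgebra K V ⧸ I) (ModTop (PathAlgebra K V ⧸ I) (RepModule z)) T}

variable (I d) in
/-- `T` is realizable with respect to `d`. -/
def IsRealizable (T : Type x) [AddCommGroup T] [Module (PathAlgebra K V ⧸ I) T] : Prop :=
  (RepTop I d T).Nonempty

end Rep

end QuiverRep

end

noncomputable section

namespace QuiverRep


/-! ### Multiplication of paths; arrows lie in the radical -/

section Algebra

variable {K : Type u} [Field K] {V : Type v} [Fintype V] [Quiver.{w} V]

/-! As `I` is admissible and `J² = 0`, a point of `Rep I d` is just a family of matrices in which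
any two consecutive arrows multiply to zero. At each vertex `b`, the span `R_b` of the images of the
incoming arrows (`inRange`) thus lies in the common kernel `C_b` of the outgoing arrows (`outKer`).
Since `R_b` is the part of `J M` at `b`, the numbers `dim R_b` determine the top of `M`, and
conversely (`modIso_top_iff`). Let `r_b` be their values for the top `T`.

Everything passes through one condition on `X`, `HasSocleQuotient`: some submodule `S` contains `J
X`, is killed by the arrows, and has `X / S ≅ T`.

Necessity is semicontinuity of rank. On `Rep_d^T`, the incoming matrix at `b` has rank `r_b`, and
the outgoing one has rank at most `d_b - r_b` because `R_b ≤ C_b`. Both upper bounds persist in the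
closure, so a subspace `S_b` of dimension `r_b` fits between `R_b` and `C_b`; these subspaces form
`S` (`hasSocleQuotient_of_mem_zariskiClosure`).

Sufficiency is an explicit line (`exists_mem_zariskiClosure_glOrbit`). Given `S` in the module of
`z`, choose matrices `x` which vanish on `S`, have image in `S`, and fill up `R_b` to `S_b`. A
dimension count on any point with top `T` leaves room for them. Then `z + x` has top `T`, and
scaling a complement of `R_b` in `S_b` by `c ≠ 0` conjugates `z + x` to `z + c x`. As `K` is
infinite, `z` is in the closure of this one orbit, which gives (a).

Finally, such an `S` exists exactly if `X = X' ⊕ U` with `top X' ≅ T` and `U` semisimple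
(`hasSocleQuotient_iff`): `S` corresponds to `J X' ⊕ U`. -/

theorem subalgebra_eq_top (S : Subalgebra K (PathAlgebra K V))
    (hv : ∀ i : V, vertex K i ∈ S) (ha : ∀ (a b : V) (α : a ⟶ b), arrow K α ∈ S) : S = ⊤ := by
  have h : Algebra.adjoin K (Set.range (FreeAlgebra.ι K)) ≤
      S.comap (RingQuot.mkAlgHom K (PathRel K V)) := by
    rw [Algebra.adjoin_le_iff]
    rintro _ ⟨i | ⟨a, b, α⟩, rfl⟩
    · exact hv i
    · exact ha a b α
  rw [FreeAlgebra.adjoin_range_ι] at h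
  rw [eq_top_iff]
  intro p _
  obtain ⟨q, rfl⟩ := RingQuot.mkAlgHom_surjective K (PathRel K V) p
  exact h (Algebra.mem_top (x := q))

theorem vertex_mul_self (i : V) : vertex K i * vertex K i = vertex K i := by
  rw [vertex, ← map_mul]
  exact RingQuot.mkAlgHom_rel K (PathRel.idem i)

theorem vertex_mul_of_ne {i j : V} (h : i ≠ j) : vertex K i * vertex K j = 0 := by
  rw [vertex, vertex, ← map_mul, ← map_zero (RingQuot.mkAlgHom K (PathRel K V))]
  exact RingQuot.mkAlgHom_rel K (PathRel.orth i j h)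

variable (K V) in
theorem sum_vertex : ∑ i : V, vertex K i = 1 := by
  simp only [vertex]
  rw [← map_sum, ← map_one (RingQuot.mkAlgHom K (PathRel K V))]
  exact RingQuot.mkAlgHom_rel K PathRel.one

theorem vertex_mul_arrow {a b : V} (α : a ⟶ b) : vertex K b * arrow K α = arrow K α := by
  rw [vertex, arrow, ← map_mul]
  exact RingQuot.mkAlgHom_rel K (PathRel.target α)

theorem arrow_mul_vertex {a b : V} (α : a ⟶ b) : arrow K α * vertex K a = arrow K α := by
  rw [vertex, arrow, ← map_mul]
  exact RingQuot.mkAlgHom_rel K (PathRel.source α)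

theorem vertex_mul_ofPath {a b : V} (p : Quiver.Path a b) :
    vertex K b * ofPath K p = ofPath K p := by
  cases p with
  | nil => exact vertex_mul_self a
  | cons p α => rw [ofPath, ← mul_assoc, vertex_mul_arrow]

theorem ofPath_mul_vertex {a b : V} (p : Quiver.Path a b) :
    ofPath K p * vertex K a = ofPath K p := by
  induction p with
  | nil => exact vertex_mul_self a
  | cons p α ih => rw [ofPath, mul_assoc, ih]

theorem ofPath_mul_ofPath {a b c : V} (p : Quiver.Path b c) (q : Quiver.Path a b) :
    ofPath K p * ofPath K q = ofPath K (q.comp p) := by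
  induction p with
  | nil => exact vertex_mul_ofPath q
  | cons p α ih => rw [Quiver.Path.comp_cons, ofPath, ofPath, mul_assoc, ih]

theorem ofPath_mul_ofPath_of_ne {a b b' c : V} (p : Quiver.Path b c) (q : Quiver.Path a b')
    (h : b ≠ b') : ofPath K p * ofPath K q = 0 := by
  rw [← ofPath_mul_vertex p, ← vertex_mul_ofPath q, mul_assoc, ← mul_assoc (vertex K b),
    vertex_mul_of_ne h, zero_mul, mul_zero]

theorem mul_mem_arrowIdealPow {m n : ℕ} {p q : PathAlgebra K V} (hp : p ∈ arrowIdealPow K V m)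
    (hq : q ∈ arrowIdealPow K V n) : p * q ∈ arrowIdealPow K V (m + n) := by
  suffices arrowIdealPow K V m * arrowIdealPow K V n ≤ arrowIdealPow K V (m + n) from
    this (Submodule.mul_mem_mul hp hq)
  rw [arrowIdealPow, arrowIdealPow, Submodule.span_mul_span, Submodule.span_le]
  rintro _ ⟨_, ⟨b, c, p, hp, rfl⟩, _, ⟨a, b', q, hq, rfl⟩, rfl⟩
  by_cases h : b = b'
  · subst h
    refine Submodule.subset_span ⟨a, c, q.comp p, ?_, ofPath_mul_ofPath p q⟩
    rw [Quiver.Path.length_comp]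
    omega
  · dsimp only
    rw [ofPath_mul_ofPath_of_ne p q h]
    exact zero_mem _

theorem arrow_mem_arrowIdealPow {a b : V} (α : a ⟶ b) : arrow K α ∈ arrowIdealPow K V 1 := by
  have h : arrow K α = ofPath K (Quiver.Path.nil.cons α) := by
    rw [ofPath, ofPath, arrow_mul_vertex]
  exact Submodule.subset_span ⟨a, b, Quiver.Path.nil.cons α, le_rfl, h⟩

theorem vertex_mem_arrowIdealPow_zero (i : V) : vertex K i ∈ arrowIdealPow K V 0 :=
  Submodule.subset_span ⟨i, i, Quiver.Path.nil, Nat.zero_le _, rfl⟩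

theorem arrowIdealPow_anti {m n : ℕ} (h : m ≤ n) : arrowIdealPow K V n ≤ arrowIdealPow K V m :=
  Submodule.span_mono fun _ ⟨a, b, p, hp, hz⟩ => ⟨a, b, p, h.trans hp, hz⟩

/-- The span of all paths is closed under multiplication and contains the generators. -/
theorem mem_arrowIdealPow_zero (p : PathAlgebra K V) : p ∈ arrowIdealPow K V 0 := by
  let S : Subalgebra K (PathAlgebra K V) :=
    Submodule.toSubalgebra (arrowIdealPow K V 0)
      (by rw [← sum_vertex K V]; exact sum_mem fun i _ => vertex_mem_arrowIdealPow_zero i)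
      (fun p q hp hq => (zero_add 0) ▸ mul_mem_arrowIdealPow hp hq)
  have hS : S = ⊤ := subalgebra_eq_top S (fun i => vertex_mem_arrowIdealPow_zero i)
    (fun a b α => arrowIdealPow_anti zero_le_one (arrow_mem_arrowIdealPow α))
  exact hS.ge (Algebra.mem_top (x := p))

theorem pow_mem_arrowIdealPow {p : PathAlgebra K V} (hp : p ∈ arrowIdealPow K V 1) (m : ℕ) :
    p ^ m ∈ arrowIdealPow K V m := by
  induction m with
  | zero => exact mem_arrowIdealPow_zero _
  | succ m ih => rw [pow_succ]; exact mul_mem_arrowIdealPow ih hp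

variable (I : Ideal (PathAlgebra K V)) [I.IsTwoSided]

/-- The class of the path algebra generator `e_i` in the quotient algebra. -/
abbrev qVertex (i : V) : PathAlgebra K V ⧸ I := Ideal.Quotient.mk I (vertex K i)

/-- The class of an arrow in the quotient algebra. -/
abbrev qArrow {a b : V} (α : a ⟶ b) : PathAlgebra K V ⧸ I := Ideal.Quotient.mk I (arrow K α)

/-- Any left multiple of an arrow stays in the arrow ideal, a power of which lies in `I`. So it is
nilpotent in the quotient, and adding `1` gives a unit. -/
theorem qArrow_mem_jacobson (hI : IsAdmissible I) {a b : V} (α : a ⟶ b) :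
    qArrow I α ∈ Ring.jacobson (PathAlgebra K V ⧸ I) := by
  rw [← Ideal.jacobson_bot, Ideal.mem_jacobson_iff]
  intro r
  obtain ⟨p, rfl⟩ := Ideal.Quotient.mk_surjective r
  obtain ⟨m, hm⟩ := hI.2
  have hnil : IsNilpotent (Ideal.Quotient.mk I p * qArrow I α) := by
    refine ⟨m, ?_⟩
    rw [← map_mul, ← map_pow, Ideal.Quotient.eq_zero_iff_mem]
    have h := mul_mem_arrowIdealPow (mem_arrowIdealPow_zero p) (arrow_mem_arrowIdealPow (K := K) α)
    exact hm (pow_mem_arrowIdealPow (by simpa using h) m)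
  obtain ⟨s, hs⟩ := hnil.isUnit_one_add.exists_left_inv
  refine ⟨s, ?_⟩
  rw [Submodule.mem_bot, ← hs]
  noncomm_ring

theorem qArrow_mul_qArrow (hI : IsAdmissible I)
    (hJ : ∀ r ∈ Ring.jacobson (PathAlgebra K V ⧸ I), ∀ s ∈ Ring.jacobson (PathAlgebra K V ⧸ I),
      r * s = 0) {a b c e : V} (β : c ⟶ e) (α : a ⟶ b) : qArrow I β * qArrow I α = 0 :=
  hJ _ (qArrow_mem_jacobson I hI β) _ (qArrow_mem_jacobson I hI α)

end Algebra

/-! ### Modules over the quotient algebra: semisimplicity and radical in terms of arrows -/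

section Modules

variable {K : Type u} [Field K] {V : Type v} [Fintype V] [Quiver.{w} V]
  {I : Ideal (PathAlgebra K V)} [I.IsTwoSided]

/-- Linearity and stability need checking only on vertices and arrows: the elements for which such a
property holds form a subalgebra. -/
theorem quotient_subalgebra_eq_top (S : Subalgebra K (PathAlgebra K V ⧸ I))
    (hv : ∀ i : V, qVertex I i ∈ S) (ha : ∀ (a b : V) (α : a ⟶ b), qArrow I α ∈ S) :
    S = ⊤ := by
  have h := subalgebra_eq_top (S.comap (Ideal.Quotient.mkₐ K I)) hv ha
  rw [eq_top_iff]
  intro r _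
  obtain ⟨p, rfl⟩ := Ideal.Quotient.mk_surjective r
  exact h.ge (Algebra.mem_top (x := p))

section Linear

variable {X : Type x} [AddCommGroup X] [Module K X] [Module (PathAlgebra K V ⧸ I) X]
  [IsScalarTower K (PathAlgebra K V ⧸ I) X]
  {Y : Type y} [AddCommGroup Y] [Module K Y] [Module (PathAlgebra K V ⧸ I) Y]
  [IsScalarTower K (PathAlgebra K V ⧸ I) Y]

theorem map_smul_of_generators (f : X →ₗ[K] Y)
    (hv : ∀ (i : V) (m : X), f (qVertex I i • m) = qVertex I i • f m)
    (ha : ∀ (a b : V) (α : a ⟶ b) (m : X), f (qArrow I α • m) = qArrow I α • f m)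
    (r : PathAlgebra K V ⧸ I) (m : X) : f (r • m) = r • f m := by
  let S : Subalgebra K (PathAlgebra K V ⧸ I) :=
    { carrier := {r | ∀ m : X, f (r • m) = r • f m}
      mul_mem' := fun {r s} hr hs m => by
        rw [mul_smul, mul_smul, hr, hs]
      add_mem' := fun {r s} hr hs m => by
        rw [add_smul, add_smul, map_add, hr, hs]
      algebraMap_mem' := fun c m => by
        rw [algebraMap_smul, algebraMap_smul, map_smul] }
  have hS : S = ⊤ := quotient_subalgebra_eq_top S hv (fun a b α => ha a b α)
  exact hS.ge (Algebra.mem_top (x := r)) m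

/-- A `K`-linear equivalence which commutes with vertices and arrows, as an equivalence of
modules over the quotient of the path algebra. -/
def equivOfGenerators (f : X ≃ₗ[K] Y)
    (hv : ∀ (i : V) (m : X), f (qVertex I i • m) = qVertex I i • f m)
    (ha : ∀ (a b : V) (α : a ⟶ b) (m : X), f (qArrow I α • m) = qArrow I α • f m) :
    X ≃ₗ[PathAlgebra K V ⧸ I] Y :=
  { f with map_smul' := fun r m => map_smul_of_generators f.toLinearMap hv ha r m }

/-- A `K`-subspace which is stable under vertices and arrows, as a submodule. -/
def submoduleOfGenerators (N : Submodule K X) (hv : ∀ (i : V), ∀ m ∈ N, qVertex I i • m ∈ N)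
    (ha : ∀ (a b : V) (α : a ⟶ b), ∀ m ∈ N, qArrow I α • m ∈ N) :
    Submodule (PathAlgebra K V ⧸ I) X :=
  { N with
    smul_mem' := fun r m hm => by
      let S : Subalgebra K (PathAlgebra K V ⧸ I) :=
        { carrier := {r | ∀ m ∈ N, r • m ∈ N}
          mul_mem' := fun {r s} hr hs m hm => by
            rw [mul_smul]; exact hr _ (hs _ hm)
          add_mem' := fun {r s} hr hs m hm => by
            rw [add_smul]; exact add_mem (hr _ hm) (hs _ hm)
          algebraMap_mem' := fun c m hm => by
            rw [algebraMap_smul]; exact N.smul_mem c hm }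
      have hS : S = ⊤ := quotient_subalgebra_eq_top S hv (fun a b α => ha a b α)
      exact hS.ge (Algebra.mem_top (x := r)) m hm }

end Linear

section Semisimple

variable {X : Type x} [AddCommGroup X] [Module (PathAlgebra K V ⧸ I) X]

theorem sum_qVertex_smul (m : X) : ∑ i : V, qVertex I i • m = m := by
  rw [← Finset.sum_smul, ← map_sum, sum_vertex, map_one, one_smul]

theorem qVertex_smul_self (i : V) (m : X) : qVertex I i • qVertex I i • m = qVertex I i • m := by
  rw [smul_smul, ← map_mul, vertex_mul_self]

theorem qVertex_smul_of_ne {i j : V} (h : i ≠ j) (m : X) :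
    qVertex I i • qVertex I j • m = 0 := by
  rw [smul_smul, ← map_mul, vertex_mul_of_ne h, map_zero, zero_smul]

theorem exists_smul_eq_of_qArrow_smul_eq_zero
    (h : ∀ (a b : V) (α : a ⟶ b) (m : X), qArrow I α • m = 0) (i : V)
    (r : PathAlgebra K V ⧸ I) :
    ∃ c : K, ∀ m : X, qVertex I i • m = m →
      r • m = algebraMap K (PathAlgebra K V ⧸ I) c • m := by
  classical
  let S : Subalgebra K (PathAlgebra K V ⧸ I) :=
    { carrier := {r | ∃ c : K, ∀ m : X, qVertex I i • m = m →
        r • m = algebraMap K (PathAlgebra K V ⧸ I) c • m}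
      mul_mem' := by
        rintro r s ⟨c, hc⟩ ⟨c', hc'⟩
        refine ⟨c * c', fun m hm => ?_⟩
        rw [mul_smul, hc' m hm, ← mul_smul, ← Algebra.commutes, mul_smul, hc m hm, ← mul_smul,
          ← map_mul, mul_comm]
      add_mem' := by
        rintro r s ⟨c, hc⟩ ⟨c', hc'⟩
        refine ⟨c + c', fun m hm => ?_⟩
        rw [add_smul, hc m hm, hc' m hm, map_add, add_smul]
      algebraMap_mem' := fun c => ⟨c, fun m _ => rfl⟩ }
  have hS : S = ⊤ := quotient_subalgebra_eq_top S
    (fun j => by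
      by_cases hj : j = i
      · subst hj
        exact ⟨1, fun m hm => by rw [map_one, one_smul, hm]⟩
      · exact ⟨0, fun m hm => by rw [← hm, qVertex_smul_of_ne hj, map_zero, zero_smul]⟩)
    (fun a b α => ⟨0, fun m _ => by rw [h, map_zero, zero_smul]⟩)
  exact hS.ge (Algebra.mem_top (x := r))

/-- If the arrows act as zero, the algebra acts by scalars on each `e_i X`. Hence each `e_i m` spans
a zero or simple submodule, and these submodules add up to `X`. -/
theorem isSemisimpleModule_of_qArrow_smul_eq_zero
    (h : ∀ (a b : V) (α : a ⟶ b) (m : X), qArrow I α • m = 0) :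
    IsSemisimpleModule (PathAlgebra K V ⧸ I) X := by
  refine isSemisimpleModule_of_isSemisimpleModule_submodule' (ι := V × X)
    (p := fun q => Submodule.span _ {qVertex I q.1 • q.2}) (fun q => ?_) ?_
  · by_cases h0 : qVertex I q.1 • q.2 = 0
    · rw [h0, Submodule.span_zero_singleton]
      exact (isSemisimpleModule_iff _ _).2 Subsingleton.instComplementedLattice
    · have : IsSimpleModule (PathAlgebra K V ⧸ I)
          (Submodule.span (PathAlgebra K V ⧸ I) {qVertex I q.1 • q.2}) := by
        rw [isSimpleModule_iff_isAtom]
        refine ⟨by simpa using h0, fun N hN => ?_⟩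
        by_contra hN0
        obtain ⟨n, hn, hn0⟩ := N.ne_bot_iff.1 hN0
        obtain ⟨r, rfl⟩ := Submodule.mem_span_singleton.1 (hN.le hn)
        obtain ⟨c, hc⟩ := exists_smul_eq_of_qArrow_smul_eq_zero h q.1 r
        rw [hc _ (qVertex_smul_self _ _)] at hn hn0
        have hc0 : c ≠ 0 := by
          rintro rfl
          simp at hn0
        refine hN.not_ge ?_
        rw [Submodule.span_singleton_le_iff_mem]
        have := N.smul_mem (algebraMap K (PathAlgebra K V ⧸ I) c⁻¹) hn
        rwa [smul_smul, ← map_mul, inv_mul_cancel₀ hc0, map_one, one_smul] at this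
      infer_instance
  · rw [eq_top_iff]
    intro m _
    rw [← sum_qVertex_smul (I := I) m]
    exact sum_mem fun i _ => Submodule.mem_iSup_of_mem (i, m) (Submodule.mem_span_singleton_self _)

theorem qArrow_smul_eq_zero_of_isSemisimpleModule (hI : IsAdmissible I)
    [IsSemisimpleModule (PathAlgebra K V ⧸ I) X] {a b : V} (α : a ⟶ b) (m : X) :
    qArrow I α • m = 0 :=
  Module.mem_annihilator.1 (IsSemisimpleModule.jacobson_le_annihilator _ X
    (qArrow_mem_jacobson I hI α)) m

theorem qArrow_smul_mem_radical (hI : IsAdmissible I) {a b : V} (α : a ⟶ b) (m : X) :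
    qArrow I α • m ∈ Ring.jacobson (PathAlgebra K V ⧸ I) • (⊤ : Submodule (PathAlgebra K V ⧸ I) X) :=
  Submodule.smul_mem_smul (qArrow_mem_jacobson I hI α) trivial

theorem qArrow_smul_quotient_eq_zero {N : Submodule (PathAlgebra K V ⧸ I) X}
    (hN : ∀ (a b : V) (α : a ⟶ b) (m : X), qArrow I α • m ∈ N) (a b : V) (α : a ⟶ b)
    (m : X ⧸ N) : qArrow I α • m = 0 := by
  induction m using Submodule.Quotient.induction_on with
  | _ m => rw [← Submodule.Quotient.mk_smul, Submodule.Quotient.mk_eq_zero]; exact hN a b α m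

/-- Once arrows map `X` into `N`, the quotient `X / N` is semisimple and hence killed by `J`. This
lets arrows replace the abstract radical from here on. -/
theorem radical_le_iff (hI : IsAdmissible I) {N : Submodule (PathAlgebra K V ⧸ I) X} :
    Ring.jacobson (PathAlgebra K V ⧸ I) • (⊤ : Submodule (PathAlgebra K V ⧸ I) X) ≤ N ↔
      ∀ (a b : V) (α : a ⟶ b) (m : X), qArrow I α • m ∈ N := by
  refine ⟨fun h a b α m => h (qArrow_smul_mem_radical hI α m), fun h => ?_⟩
  have := isSemisimpleModule_of_qArrow_smul_eq_zero (qArrow_smul_quotient_eq_zero h)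
  rw [Submodule.smul_le]
  intro r hr m _
  rw [← Submodule.Quotient.mk_eq_zero, Submodule.Quotient.mk_smul]
  exact Module.mem_annihilator.1 (IsSemisimpleModule.jacobson_le_annihilator _ (X ⧸ N) hr) _

end Semisimple

end Modules


/-! ### Moving a subspace to another one of the same dimension -/

section LinearAlgebra

variable {K : Type u} [Field K] {E : Type v} [AddCommGroup E] [Module K E]

theorem exists_linearEquiv_map_eq_of_finrank_eq [FiniteDimensional K E] {p q : Submodule K E}
    (h : finrank K p = finrank K q) : ∃ θ : E ≃ₗ[K] E, p.map (θ : E →ₗ[K] E) = q := by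
  obtain ⟨p', hp⟩ := p.exists_isCompl
  obtain ⟨q', hq⟩ := q.exists_isCompl
  have hp' := Submodule.finrank_add_eq_of_isCompl hp
  have hq' := Submodule.finrank_add_eq_of_isCompl hq
  let e := LinearEquiv.ofFinrankEq p q h
  let e' := LinearEquiv.ofFinrankEq (R := K) p' q' (by omega)
  let θ := (Submodule.prodEquivOfIsCompl p p' hp).symm ≪≫ₗ (e.prodCongr e') ≪≫ₗ
    Submodule.prodEquivOfIsCompl q q' hq
  have hθ : ∀ m (hm : m ∈ p), θ m = e ⟨m, hm⟩ := fun m hm => by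
    have : (Submodule.prodEquivOfIsCompl p p' hp).symm m = (⟨m, hm⟩, 0) :=
      Submodule.prodEquivOfIsCompl_symm_apply_left p p' hp ⟨m, hm⟩
    simp [θ, this]
  refine ⟨θ, le_antisymm ?_ fun m hm => ?_⟩
  · rintro _ ⟨m, hm, rfl⟩
    rw [LinearEquiv.coe_coe, hθ m hm]
    exact (e ⟨m, hm⟩).2
  · refine ⟨e.symm ⟨m, hm⟩, (e.symm ⟨m, hm⟩).2, ?_⟩
    rw [LinearEquiv.coe_coe, hθ _ (e.symm ⟨m, hm⟩).2]
    simp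

end LinearAlgebra

/-! ### The spaces `e_i X` and invariance of dimension vectors -/

section VertexSpaces

variable {K : Type u} [Field K] {V : Type v} [Fintype V] [Quiver.{w} V]
  {I : Ideal (PathAlgebra K V)} [I.IsTwoSided]
  {X : Type x} [AddCommGroup X] [Module K X] [Module (PathAlgebra K V ⧸ I) X]
  [IsScalarTower K (PathAlgebra K V ⧸ I) X]
  {Y : Type y} [AddCommGroup Y] [Module K Y] [Module (PathAlgebra K V ⧸ I) Y]
  [IsScalarTower K (PathAlgebra K V ⧸ I) Y]

variable (I X) in
/-- The subspace `e_i X`. -/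
abbrev vertexSpace (i : V) : Submodule K X :=
  LinearMap.range (Algebra.lsmul K K X (qVertex I i))

theorem mem_vertexSpace {i : V} {m : X} : m ∈ vertexSpace I X i ↔ qVertex I i • m = m := by
  refine ⟨?_, fun h => ⟨m, h⟩⟩
  rintro ⟨m, rfl⟩
  exact qVertex_smul_self i m

theorem map_vertexSpace (e : X ≃ₗ[PathAlgebra K V ⧸ I] Y) (i : V) :
    (vertexSpace I X i).map (e.restrictScalars K : X →ₗ[K] Y) = vertexSpace I Y i := by
  ext m
  simp only [Submodule.mem_map, mem_vertexSpace]
  constructor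
  · rintro ⟨m, hm, rfl⟩
    simp only [LinearEquiv.coe_coe, LinearEquiv.restrictScalars_apply]
    rw [← map_smul, hm]
  · intro hm
    exact ⟨e.symm m, by rw [← map_smul, hm], by simp⟩

theorem finrank_vertexSpace_congr (e : X ≃ₗ[PathAlgebra K V ⧸ I] Y) (i : V) :
    finrank K (vertexSpace I X i) = finrank K (vertexSpace I Y i) := by
  rw [← map_vertexSpace e i]
  exact (LinearEquiv.finrank_map_eq (e.restrictScalars K) _).symm

theorem HasDimVector.congr {d : V → ℕ} (h : HasDimVector I d X)
    (e : X ≃ₗ[PathAlgebra K V ⧸ I] Y) : HasDimVector I d Y := by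
  have := h.1
  exact ⟨(e.restrictScalars K).finiteDimensional, fun i =>
    (finrank_vertexSpace_congr e i).symm.trans (h.2 i)⟩

end VertexSpaces

/-! ### Modules of points of the representation variety -/

section RepModule

variable {K : Type u} [Field K] {V : Type v} [Fintype V] [Quiver.{w} V] [DecidableEq V]
  {I : Ideal (PathAlgebra K V)} {d : V → ℕ}

theorem pathAction_vertex (z : RepSpace K d) (i : V) (m : ∀ i : V, Fin (d i) → K) :
    pathAction z (vertex K i) m = Pi.single i (m i) := by
  rw [pathAction, vertex, RingQuot.liftAlgHom_mkAlgHom_apply, FreeAlgebra.lift_ι_apply]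
  rfl

theorem pathAction_arrow (z : RepSpace K d) {a b : V} (α : a ⟶ b) (m : ∀ i : V, Fin (d i) → K) :
    pathAction z (arrow K α) m = Pi.single b ((z α).mulVec (m a)) := by
  rw [pathAction, arrow, RingQuot.liftAlgHom_mkAlgHom_apply, FreeAlgebra.lift_ι_apply]
  rfl

theorem pathAction_ofPath_of_two_le {z : RepSpace K d}
    (hz : ∀ ⦃a b c : V⦄ (α : a ⟶ b) (β : b ⟶ c), z β * z α = 0) {a b : V}
    (p : Quiver.Path a b) (hp : 2 ≤ p.length) : pathAction z (ofPath K p) = 0 := by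
  cases p with
  | nil => simp at hp
  | cons p β =>
    cases p with
    | nil => simp at hp
    | cons p α =>
      rw [ofPath, ofPath, map_mul, map_mul, ← mul_assoc]
      have : pathAction z (arrow K β) * pathAction z (arrow K α) = 0 := by
        refine LinearMap.ext fun m => ?_
        rw [Module.End.mul_apply, pathAction_arrow, pathAction_arrow, Pi.single_eq_same,
          Matrix.mulVec_mulVec, hz, Matrix.zero_mulVec, Pi.single_zero]
        rfl
      rw [this, zero_mul]

/-- Every element of `I` is a combination of paths of length at least two, and each of these
contains two consecutive arrows. Together with `mul_eq_zero_of_mem_rep` this removes `I` from the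
description of the variety. -/
theorem mem_rep_of_mul_eq_zero (hI : IsAdmissible I) {z : RepSpace K d}
    (hz : ∀ ⦃a b c : V⦄ (α : a ⟶ b) (β : b ⟶ c), z β * z α = 0) : z ∈ Rep I d := by
  intro r hr
  have h : arrowIdealPow K V 2 ≤ LinearMap.ker (pathAction z).toLinearMap := by
    rw [arrowIdealPow, Submodule.span_le]
    rintro _ ⟨a, b, p, hp, rfl⟩
    exact pathAction_ofPath_of_two_le hz p hp
  exact h (hI.1 hr)

instance (z : Rep I d) : Module K (RepModule z) :=
  inferInstanceAs (Module K (∀ i : V, Fin (d i) → K))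

instance (z : Rep I d) : FiniteDimensional K (RepModule z) :=
  inferInstanceAs (FiniteDimensional K (∀ i : V, Fin (d i) → K))

/-- The inclusion of the summand `K^{d_b}` into the module of a point. -/
def incl (z : Rep I d) (b : V) : (Fin (d b) → K) →ₗ[K] RepModule z :=
  LinearMap.single K (fun j : V => Fin (d j) → K) b

/-- The projection of the module of a point onto the summand `K^{d_b}`. -/
def component (z : Rep I d) (b : V) : RepModule z →ₗ[K] (Fin (d b) → K) :=
  LinearMap.proj (R := K) (φ := fun j : V => Fin (d j) → K) b

theorem component_incl (z : Rep I d) (b : V) (v : Fin (d b) → K) :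
    component z b (incl z b v) = v := Pi.single_eq_same (M := fun j : V => Fin (d j) → K) b v

theorem component_incl_of_ne (z : Rep I d) {a b : V} (h : b ≠ a) (v : Fin (d a) → K) :
    component z b (incl z a v) = 0 := Pi.single_eq_of_ne (M := fun j : V => Fin (d j) → K) h v

theorem repModule_ext {z : Rep I d} {m n : RepModule z}
    (h : ∀ b, component z b m = component z b n) : m = n := funext h

variable [I.IsTwoSided]

theorem mk_smul_eq_pathAction (z : Rep I d) (p : PathAlgebra K V) (m : RepModule z) :
    Ideal.Quotient.mk I p • m = pathAction (z : RepSpace K d) p m := rfl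

instance (z : Rep I d) : IsScalarTower K (PathAlgebra K V ⧸ I) (RepModule z) :=
  ⟨fun c r m => by
    obtain ⟨p, rfl⟩ := Ideal.Quotient.mk_surjective r
    rw [← Ideal.Quotient.mkₐ_eq_mk K, ← map_smul, Ideal.Quotient.mkₐ_eq_mk, mk_smul_eq_pathAction,
      mk_smul_eq_pathAction, map_smul]
    rfl⟩

theorem qVertex_smul (z : Rep I d) (i : V) (m : RepModule z) :
    qVertex I i • m = incl z i (component z i m) := pathAction_vertex _ i m

theorem qArrow_smul (z : Rep I d) {a b : V} (α : a ⟶ b) (m : RepModule z) :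
    qArrow I α • m = incl z b (((z : RepSpace K d) α).mulVec (component z a m)) :=
  pathAction_arrow _ α m

theorem sum_incl_component (z : Rep I d) (m : RepModule z) :
    ∑ b : V, incl z b (component z b m) = m := by
  conv_rhs => rw [← sum_qVertex_smul (I := I) m]
  simp only [qVertex_smul]

theorem mul_eq_zero_of_mem_rep (hI : IsAdmissible I)
    (hJ : ∀ r ∈ Ring.jacobson (PathAlgebra K V ⧸ I), ∀ s ∈ Ring.jacobson (PathAlgebra K V ⧸ I),
      r * s = 0) (z : Rep I d) {a b c : V} (α : a ⟶ b) (β : b ⟶ c) :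
    (z : RepSpace K d) β * (z : RepSpace K d) α = 0 := by
  refine Matrix.toLin'.injective (LinearMap.ext fun v => ?_)
  have h := congrArg (· • incl z a v) (qArrow_mul_qArrow I hI hJ β α)
  simp only [mul_smul, zero_smul, qArrow_smul, component_incl] at h
  rw [Matrix.toLin'_apply, ← Matrix.mulVec_mulVec, map_zero, LinearMap.zero_apply]
  simpa only [component_incl, map_zero] using congrArg (component z c) h

theorem hasDimVector_repModule (z : Rep I d) : HasDimVector I d (RepModule z) := by
  refine ⟨inferInstance, fun i => ?_⟩
  have h : LinearMap.range (Algebra.lsmul K K (RepModule z) (qVertex I i)) =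
      LinearMap.range (incl z i) := by
    ext m
    constructor
    · rintro ⟨m, rfl⟩
      exact ⟨component z i m, (qVertex_smul z i m).symm⟩
    · rintro ⟨v, rfl⟩
      exact ⟨incl z i v, (qVertex_smul z i _).trans (by rw [component_incl])⟩
  rw [h, LinearMap.finrank_range_of_inj, Module.finrank_fin_fun]
  intro v w hvw
  rw [← component_incl z i v, hvw, component_incl]

/-- The intersection of a submodule with the summand `K^{d_b}`. -/
def piece {z : Rep I d} (N : Submodule (PathAlgebra K V ⧸ I) (RepModule z)) (b : V) :
    Submodule K (Fin (d b) → K) :=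
  (N.restrictScalars K).comap (incl z b)

theorem mem_piece {z : Rep I d} {N : Submodule (PathAlgebra K V ⧸ I) (RepModule z)} {b : V}
    {v : Fin (d b) → K} : v ∈ piece N b ↔ incl z b v ∈ N := Iff.rfl

theorem mem_iff_component_mem_piece {z : Rep I d}
    {N : Submodule (PathAlgebra K V ⧸ I) (RepModule z)} {m : RepModule z} :
    m ∈ N ↔ ∀ b, component z b m ∈ piece N b := by
  refine ⟨fun h b => ?_, fun h => ?_⟩
  · rw [mem_piece, ← qVertex_smul]
    exact N.smul_mem _ h
  · rw [← sum_incl_component z m]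
    exact sum_mem fun b _ => mem_piece.1 (h b)

/-- Rank-nullity for the map from `K^{d_b}` onto the part of the quotient at `b`. -/
theorem finrank_vertexSpace_quotient_add {z : Rep I d}
    (N : Submodule (PathAlgebra K V ⧸ I) (RepModule z)) (b : V) :
    finrank K (vertexSpace I (RepModule z ⧸ N) b) + finrank K (piece N b) = d b := by
  let g : (Fin (d b) → K) →ₗ[K] RepModule z ⧸ N := N.mkQ.restrictScalars K ∘ₗ incl z b
  have hr : LinearMap.range g = vertexSpace I (RepModule z ⧸ N) b := by
    ext m
    constructor
    · rintro ⟨v, rfl⟩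
      refine ⟨N.mkQ (incl z b v), ?_⟩
      rw [Algebra.lsmul_coe]
      beta_reduce
      rw [← map_smul, qVertex_smul, component_incl]
      rfl
    · rintro ⟨m, rfl⟩
      obtain ⟨m, rfl⟩ := N.mkQ_surjective m
      refine ⟨component z b m, ?_⟩
      rw [Algebra.lsmul_coe]
      beta_reduce
      rw [← map_smul, qVertex_smul]
      rfl
  have hk : LinearMap.ker g = piece N b := by
    ext v
    exact N.mkQ.mem_ker.symm.trans (by rw [Submodule.ker_mkQ]; rfl) |>.trans Iff.rfl
  rw [← hr, ← hk, LinearMap.finrank_range_add_finrank_ker, Module.finrank_fin_fun]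

theorem finrank_piece_eq_of_equiv {z y : Rep I d}
    {N : Submodule (PathAlgebra K V ⧸ I) (RepModule z)}
    {N' : Submodule (PathAlgebra K V ⧸ I) (RepModule y)}
    (e : (RepModule z ⧸ N) ≃ₗ[PathAlgebra K V ⧸ I] (RepModule y ⧸ N')) (b : V) :
    finrank K (piece N b) = finrank K (piece N' b) := by
  have h := finrank_vertexSpace_quotient_add N b
  have h' := finrank_vertexSpace_quotient_add N' b
  rw [finrank_vertexSpace_congr e b] at h
  omega

/-- On both quotients the arrows act as zero, so any linear isomorphism that respects the vertices
is a module isomorphism. One is induced by automorphisms of the spaces `K^{d_b}` carrying one family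
of pieces to the other. -/
theorem modIso_quotient_of_finrank_piece_eq {z y : Rep I d}
    {N : Submodule (PathAlgebra K V ⧸ I) (RepModule z)}
    {N' : Submodule (PathAlgebra K V ⧸ I) (RepModule y)}
    (hN : ∀ (a b : V) (α : a ⟶ b) (m : RepModule z), qArrow I α • m ∈ N)
    (hN' : ∀ (a b : V) (α : a ⟶ b) (m : RepModule y), qArrow I α • m ∈ N')
    (h : ∀ b, finrank K (piece N b) = finrank K (piece N' b)) :
    ModIso (PathAlgebra K V ⧸ I) (RepModule z ⧸ N) (RepModule y ⧸ N') := by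
  choose θ hθ using fun b => exists_linearEquiv_map_eq_of_finrank_eq (h b)
  let Θ : RepModule z ≃ₗ[K] RepModule y := LinearEquiv.piCongrRight θ
  have hc : ∀ b m, component y b (Θ m) = θ b (component z b m) := fun b m => rfl
  have hi : ∀ b v, Θ (incl z b v) = incl y b (θ b v) := fun b v => by
    refine repModule_ext fun c => ?_
    rw [hc]
    by_cases hcb : c = b
    · subst hcb
      rw [component_incl, component_incl]
    · rw [component_incl_of_ne z hcb, component_incl_of_ne y hcb, map_zero]
  have hmap : (N.restrictScalars K).map (Θ : RepModule z →ₗ[K] RepModule y) =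
      N'.restrictScalars K := by
    ext m
    rw [Submodule.mem_map_equiv, Submodule.restrictScalars_mem, Submodule.restrictScalars_mem,
      mem_iff_component_mem_piece, mem_iff_component_mem_piece]
    refine forall_congr' fun b => ?_
    rw [← hθ b, Submodule.mem_map_equiv]
    rfl
  let e : (RepModule z ⧸ N) ≃ₗ[K] (RepModule y ⧸ N') :=
    (Submodule.Quotient.restrictScalarsEquiv K N).symm ≪≫ₗ
      Submodule.Quotient.equiv _ _ Θ hmap ≪≫ₗ Submodule.Quotient.restrictScalarsEquiv K N'
  have he : ∀ m, e (Submodule.Quotient.mk m) = Submodule.Quotient.mk (Θ m) := fun m => rfl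
  refine ⟨equivOfGenerators e (fun i m => ?_) (fun a b α m => ?_)⟩
  · induction m using Submodule.Quotient.induction_on with
    | _ m =>
      rw [← Submodule.Quotient.mk_smul, he, he, ← Submodule.Quotient.mk_smul, qVertex_smul,
        qVertex_smul, hi, hc]
  · rw [qArrow_smul_quotient_eq_zero hN, qArrow_smul_quotient_eq_zero hN', map_zero]

/-- Bases of the spaces `e_i X` turn the arrows into matrices. The maps `F` and `G` assemble `X`
from these spaces and take it apart. -/
theorem exists_modIso_repModule {X : Type x} [AddCommGroup X] [Module K X]
    [Module (PathAlgebra K V ⧸ I) X] [IsScalarTower K (PathAlgebra K V ⧸ I) X]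
    (h : HasDimVector I d X) : ∃ z : Rep I d, ModIso (PathAlgebra K V ⧸ I) X (RepModule z) := by
  have := h.1
  let e : ∀ i, (Fin (d i) → K) ≃ₗ[K] vertexSpace I X i := fun i =>
    LinearEquiv.ofFinrankEq _ _ (by rw [Module.finrank_fin_fun]; exact (h.2 i).symm)
  let F : (∀ i : V, Fin (d i) → K) →ₗ[K] X :=
    ∑ i, (vertexSpace I X i).subtype ∘ₗ (e i).toLinearMap ∘ₗ LinearMap.proj i
  have hF : ∀ m, F m = ∑ i, (e i (m i) : X) := fun m => by simp [F]
  have hev : ∀ i v, qVertex I i • (e i v : X) = e i v := fun i v => mem_vertexSpace.1 (e i v).2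
  have hFv : ∀ i m, qVertex I i • F m = e i (m i) := fun i m => by
    rw [hF, Finset.smul_sum, Finset.sum_eq_single i, hev]
    · intro j _ hj
      rw [← hev, qVertex_smul_of_ne hj.symm]
    · simp
  let G : X →ₗ[K] (∀ i : V, Fin (d i) → K) := LinearMap.pi fun i =>
    (e i).symm.toLinearMap ∘ₗ (Algebra.lsmul K K X (qVertex I i)).rangeRestrict
  have hG : ∀ m i, e i (G m i) = qVertex I i • m := fun m i => by
    simp only [G, LinearMap.pi_apply, LinearMap.comp_apply, LinearEquiv.coe_coe,
      LinearEquiv.apply_symm_apply]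
    rfl
  let Φ : (∀ i : V, Fin (d i) → K) ≃ₗ[K] X := LinearEquiv.ofLinearMap F G
    (LinearMap.ext fun m => by
      rw [LinearMap.comp_apply, hF]
      simp only [hG, sum_qVertex_smul, LinearMap.id_apply])
    (LinearMap.ext fun m => funext fun i => (e i).injective (Subtype.ext (by
      rw [LinearMap.comp_apply, hG, hFv, LinearMap.id_apply])))
  have hΦ : ∀ m, Φ m = F m := fun m => rfl
  let z : RepSpace K d := fun a b α => LinearMap.toMatrix'
    ((LinearMap.proj b) ∘ₗ G ∘ₗ (Algebra.lsmul K K X (qArrow I α)) ∘ₗ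
      (vertexSpace I X a).subtype ∘ₗ (e a).toLinearMap)
  have hz : ∀ a b (α : a ⟶ b) v, (e b ((z α).mulVec v) : X) = qArrow I α • (e a v : X) := by
    intro a b α v
    rw [← Matrix.toLin'_apply, Matrix.toLin'_toMatrix']
    change (e b (G (qArrow I α • (e a v : X)) b) : X) = _
    rw [hG, smul_smul, ← map_mul, vertex_mul_arrow]
  have hFs : ∀ i v, F (Pi.single i v) = e i v := fun i v => by
    rw [hF, Finset.sum_eq_single i, Pi.single_eq_same]
    · intro j _ hj
      rw [Pi.single_eq_of_ne hj, map_zero, ZeroMemClass.coe_zero]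
    · simp
  have hvert : ∀ i m, F (pathAction z (vertex K i) m) = qVertex I i • F m := fun i m => by
    rw [pathAction_vertex, hFs, hFv]
  have harr : ∀ a b (α : a ⟶ b) m, F (pathAction z (arrow K α) m) = qArrow I α • F m := by
    intro a b α m
    rw [pathAction_arrow, hFs, hz, ← hFv, smul_smul, ← map_mul, arrow_mul_vertex]
  let S : Subalgebra K (PathAlgebra K V) :=
    { carrier := {p | ∀ m, F (pathAction z p m) = Ideal.Quotient.mk I p • F m}
      mul_mem' := fun {r s} hr hs m => by
        rw [map_mul, map_mul, mul_smul, Module.End.mul_apply, hr, hs]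
      add_mem' := fun {r s} hr hs m => by
        rw [map_add, map_add, add_smul, LinearMap.add_apply, map_add, hr, hs]
      algebraMap_mem' := fun c m => by
        rw [AlgHom.commutes, Module.algebraMap_end_apply, map_smul]
        exact (algebraMap_smul (PathAlgebra K V ⧸ I) c (F m)).symm }
  have hS : S = ⊤ := subalgebra_eq_top S hvert harr
  have hS' : ∀ p m, F (pathAction z p m) = Ideal.Quotient.mk I p • F m := fun p =>
    hS.ge (Algebra.mem_top (x := p))
  -- The relations hold for the matrices because they hold on `X` and `F` is an injective
  -- intertwiner.
  have hzI : z ∈ Rep I d := fun r hr => LinearMap.ext fun m => Φ.injective (by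
    rw [hΦ, hS', Ideal.Quotient.eq_zero_iff_mem.2 hr, zero_smul, LinearMap.zero_apply, map_zero])
  let Ψ : RepModule (⟨z, hzI⟩ : Rep I d) ≃ₗ[K] X := Φ
  exact ⟨⟨z, hzI⟩, ⟨(equivOfGenerators Ψ hvert harr).symm⟩⟩

end RepModule


/-! ### Linear algebra of ranks and complements -/

section Rank

variable {K : Type u} [Field K]

/-- A substitute for nonvanishing minors: with constant `P` and `Q`, `det (P * A * Q)` is polynomial
in the entries of `A`. -/
theorem exists_mul_mul_eq_one_of_le_rank {m : Type v} {n : Type w} [Fintype m] [Fintype n]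
    {A : Matrix m n K} {r : ℕ} (h : r ≤ A.rank) :
    ∃ (P : Matrix (Fin r) m K) (Q : Matrix n (Fin r) K), P * A * Q = 1 := by
  classical
  obtain ⟨j, hj⟩ := finrank_le_iff_exists_linearMap.1
    (show finrank K (Fin r → K) ≤ finrank K (LinearMap.range (Matrix.toLin' A)) by
      rw [Module.finrank_fin_fun, Matrix.toLin'_apply']
      exact h)
  obtain ⟨s, hs⟩ := (Matrix.toLin' A).rangeRestrict.exists_rightInverse_of_surjective
    (LinearMap.range_rangeRestrict _)
  obtain ⟨p, hp⟩ := ((LinearMap.range (Matrix.toLin' A)).subtype ∘ₗ j).exists_leftInverse_of_injective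
    (LinearMap.ker_eq_bot.2 (Subtype.val_injective.comp hj))
  refine ⟨LinearMap.toMatrix' p, LinearMap.toMatrix' (s ∘ₗ j), Matrix.toLin'.injective ?_⟩
  rw [Matrix.toLin'_mul, Matrix.toLin'_mul, Matrix.toLin'_toMatrix', Matrix.toLin'_toMatrix',
    Matrix.toLin'_one, ← hp]
  refine LinearMap.ext fun v => congrArg p ?_
  exact congrArg Subtype.val (LinearMap.congr_fun hs (j v))

theorem exists_le_le_finrank_eq {E : Type v} [AddCommGroup E] [Module K E]
    [FiniteDimensional K E] {p q : Submodule K E} (hpq : p ≤ q) {s : ℕ} (hp : finrank K p ≤ s)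
    (hq : s ≤ finrank K q) : ∃ S : Submodule K E, p ≤ S ∧ S ≤ q ∧ finrank K S = s := by
  induction s, hp using Nat.le_induction with
  | base => exact ⟨p, le_rfl, hpq, rfl⟩
  | succ s hs ih =>
    obtain ⟨S, hpS, hSq, hS⟩ := ih (by omega)
    have hne : ¬ q ≤ S := fun h => by
      have := Submodule.finrank_mono h
      omega
    obtain ⟨v, hvq, hvS⟩ := SetLike.not_le_iff_exists.1 hne
    exact ⟨S ⊔ Submodule.span K {v}, hpS.trans le_sup_left,
      sup_le hSq ((Submodule.span_singleton_le_iff_mem v q).2 hvq), by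
        rw [Submodule.finrank_sup_span_singleton hvS, hS]⟩

theorem exists_surjective_of_finrank_le {E : Type v} [AddCommGroup E] [Module K E]
    [FiniteDimensional K E] {F : Type w} [AddCommGroup F] [Module K F] [FiniteDimensional K F]
    (h : finrank K F ≤ finrank K E) : ∃ f : E →ₗ[K] F, Function.Surjective f := by
  obtain ⟨j, hj⟩ := finrank_le_iff_exists_linearMap.1 h
  obtain ⟨p, hp⟩ := j.exists_leftInverse_of_injective (LinearMap.ker_eq_bot.2 hj)
  exact ⟨p, fun v => ⟨j v, LinearMap.congr_fun hp v⟩⟩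

theorem exists_projection_of_disjoint {E : Type v} [AddCommGroup E] [Module K E]
    {p q : Submodule K E} (h : Disjoint p q) :
    ∃ π : E →ₗ[K] q, (∀ v : q, π v = v) ∧ p ≤ LinearMap.ker π := by
  obtain ⟨p', hp, hp'⟩ := h.exists_isCompl
  refine ⟨Submodule.projectionOnto q p' hp'.symm, fun v =>
    Submodule.projectionOnto_apply_left hp'.symm v, ?_⟩
  rwa [Submodule.ker_projectionOnto]

theorem exists_disjoint_sup_eq {E : Type v} [AddCommGroup E] [Module K E] {p q : Submodule K E}
    (h : p ≤ q) : ∃ u : Submodule K E, Disjoint p u ∧ p ⊔ u = q := by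
  obtain ⟨p', hp⟩ := p.exists_isCompl
  refine ⟨p' ⊓ q, hp.disjoint.mono_right inf_le_left, ?_⟩
  rw [← sup_inf_assoc_of_le p' h, hp.sup_eq_top, top_inf_eq]

/-- Let `U` be a complement of `range ψ` in `S`, and `N` one of `D'` in `ker ψ`. By rank-nullity the
dimension hypothesis says `dim U ≤ dim N`, so `N` maps onto `U`. Extending this map by zero on `D'`
gives `φ`; `π` projects onto `U` and kills `range ψ`. As `ψ` vanishes on `N`, the sum `ψ + φ`
reaches all of `U`, hence also `range ψ`. -/
theorem exists_complementary_map {D : Type v} [AddCommGroup D] [Module K D]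
    [FiniteDimensional K D] {E : Type w} [AddCommGroup E] [Module K E] [FiniteDimensional K E]
    (ψ : D →ₗ[K] E) {D' : Submodule K D} (hD : D' ≤ LinearMap.ker ψ) {S : Submodule K E}
    (hS : LinearMap.range ψ ≤ S) (h : finrank K S + finrank K D' ≤ finrank K D) :
    ∃ (φ : D →ₗ[K] E) (π : E →ₗ[K] E), π ∘ₗ π = π ∧ π ∘ₗ ψ = 0 ∧ π ∘ₗ φ = φ ∧
      LinearMap.range π ≤ S ∧ D' ≤ LinearMap.ker φ ∧ LinearMap.range (ψ + φ) = S := by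
  obtain ⟨U, hU, hUS⟩ := exists_disjoint_sup_eq hS
  obtain ⟨N, hN, hNk⟩ := exists_disjoint_sup_eq hD
  obtain ⟨π, hπ, hπ0⟩ := exists_projection_of_disjoint hU
  obtain ⟨ν, hν, hν0⟩ := exists_projection_of_disjoint hN
  have h1 := Submodule.finrank_sup_add_finrank_inf_eq (LinearMap.range ψ) U
  have h2 := Submodule.finrank_sup_add_finrank_inf_eq D' N
  rw [hU.eq_bot, hUS, finrank_bot] at h1
  rw [hN.eq_bot, hNk, finrank_bot] at h2
  have h3 := ψ.finrank_range_add_finrank_ker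
  obtain ⟨f, hf⟩ := exists_surjective_of_finrank_le (K := K) (E := N) (F := U) (by omega)
  have hUS' : U ≤ S := hUS ▸ le_sup_right
  have hNk' : N ≤ LinearMap.ker ψ := hNk ▸ le_sup_right
  refine ⟨U.subtype ∘ₗ f ∘ₗ ν, U.subtype ∘ₗ π, ?_, ?_, ?_, ?_, ?_, ?_⟩
  · ext v
    simp [hπ]
  · ext v
    simpa using hπ0 ⟨v, rfl⟩
  · ext v
    simp [hπ]
  · rintro _ ⟨v, rfl⟩
    exact hUS' (π v).2
  · intro v hv
    have : ν v = 0 := hν0 hv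
    simp [this]
  · apply le_antisymm
    · rintro _ ⟨v, rfl⟩
      exact S.add_mem (hS ⟨v, rfl⟩) (hUS' (f (ν v)).2)
    · have hU' : U ≤ LinearMap.range (ψ + U.subtype ∘ₗ f ∘ₗ ν) := by
        intro v hv
        obtain ⟨n, hn⟩ := hf ⟨v, hv⟩
        refine ⟨n, ?_⟩
        have : ψ n = 0 := hNk' n.2
        simp [this, hν, hn]
      rw [← hUS]
      refine sup_le ?_ hU'
      rintro _ ⟨v, rfl⟩
      have := Submodule.sub_mem _ (LinearMap.mem_range_self (ψ + U.subtype ∘ₗ f ∘ₗ ν) v)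
        (hU' (f (ν v)).2)
      simpa using this

end Rank

/-! ### Incoming and outgoing arrows at a vertex -/

section Matrices

variable {K : Type u} [Field K] {V : Type v} [Quiver.{w} V] {d : V → ℕ}

variable (d) in
/-- The index set of a basis of `⨁_{α : a ⟶ b} K^{d_a}`. -/
abbrev InIndex (b : V) : Type (max v w) := Σ p : (Σ a : V, (a ⟶ b)), Fin (d p.1)

variable (d) in
/-- The index set of a basis of `⨁_{β : b ⟶ c} K^{d_c}`. -/
abbrev OutIndex (b : V) : Type (max v w) := Σ p : (Σ c : V, (b ⟶ c)), Fin (d p.1)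

/-- The matrix of the map `⨁_{α : a ⟶ b} K^{d_a} → K^{d_b}`. -/
def inMatrix (z : RepSpace K d) (b : V) : Matrix (Fin (d b)) (InIndex d b) K :=
  fun i q => z q.1.2 i q.2

/-- The matrix of the map `K^{d_b} → ⨁_{β : b ⟶ c} K^{d_c}`. -/
def outMatrix (z : RepSpace K d) (b : V) : Matrix (OutIndex d b) (Fin (d b)) K :=
  fun q j => z q.1.2 q.2 j

/-- The common kernel of the outgoing arrows at the vertex `b`. -/
abbrev outKer (z : RepSpace K d) (b : V) : Submodule K (Fin (d b) → K) :=
  LinearMap.ker (outMatrix z b).mulVecLin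

theorem mem_outKer {z : RepSpace K d} {b : V} {v : Fin (d b) → K} :
    v ∈ outKer z b ↔ ∀ (c : V) (β : b ⟶ c), (z β).mulVec v = 0 := by
  rw [LinearMap.mem_ker, Matrix.mulVecLin_apply]
  constructor
  · intro h c β
    ext j
    exact congrFun h ⟨⟨c, β⟩, j⟩
  · intro h
    ext ⟨⟨c, β⟩, j⟩
    exact congrFun (h c β) j

theorem finrank_outKer_add_rank (z : RepSpace K d) (b : V) :
    finrank K (outKer z b) + (outMatrix z b).rank = d b := by
  rw [add_comm, Matrix.rank, LinearMap.finrank_range_add_finrank_ker, Module.finrank_fin_fun]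

/-- The subspace `⨁_{α : a ⟶ b} S_a` of `⨁_{α : a ⟶ b} K^{d_a}`. -/
def inBlocks (S : ∀ a : V, Submodule K (Fin (d a) → K)) (b : V) :
    Submodule K (InIndex d b → K) :=
  (Submodule.pi Set.univ fun p : (Σ a : V, (a ⟶ b)) => S p.1).comap
    (LinearEquiv.piCurry K fun (p : (Σ a : V, (a ⟶ b))) (_ : Fin (d p.1)) => K).toLinearMap

theorem mem_inBlocks {S : ∀ a : V, Submodule K (Fin (d a) → K)} {b : V} {v : InIndex d b → K} :
    v ∈ inBlocks S b ↔ ∀ p : (Σ a : V, (a ⟶ b)), (fun j => v ⟨p, j⟩) ∈ S p.1 := by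
  rw [inBlocks, Submodule.mem_comap, Submodule.mem_pi]
  exact ⟨fun h p => h p trivial, fun h p _ => h p⟩

variable [Fintype V] [∀ a b : V, Fintype (a ⟶ b)]

/-- The image of the incoming arrows at the vertex `b`. -/
abbrev inRange (z : RepSpace K d) (b : V) : Submodule K (Fin (d b) → K) :=
  LinearMap.range (inMatrix z b).mulVecLin

theorem inMatrix_mulVec (z : RepSpace K d) (b : V) (v : InIndex d b → K) :
    (inMatrix z b).mulVec v = ∑ p : (Σ a : V, (a ⟶ b)), (z p.2).mulVec (fun j => v ⟨p, j⟩) := by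
  ext i
  rw [Finset.sum_apply]
  exact Fintype.sum_sigma _

/-- The vector `w` is `v` placed in the block of `α`, with zeros elsewhere. It transfers statements
about the incoming matrix to single arrows. -/
theorem exists_inMatrix_mulVec_eq (z : RepSpace K d) {a b : V} (α : a ⟶ b) (v : Fin (d a) → K) :
    ∃ w : InIndex d b → K, (inMatrix z b).mulVec w = (z α).mulVec v ∧
      ∀ S : ∀ a : V, Submodule K (Fin (d a) → K), v ∈ S a → w ∈ inBlocks S b := by
  classical
  let y : ∀ p : (Σ a : V, (a ⟶ b)), Fin (d p.1) → K := Pi.single ⟨a, α⟩ v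
  have hy : y ⟨a, α⟩ = v :=
    Pi.single_eq_same (M := fun p : (Σ a : V, (a ⟶ b)) => Fin (d p.1) → K) ⟨a, α⟩ v
  have hy0 : ∀ p, p ≠ ⟨a, α⟩ → y p = 0 := fun p hp =>
    Pi.single_eq_of_ne (M := fun p : (Σ a : V, (a ⟶ b)) => Fin (d p.1) → K) hp v
  refine ⟨fun q => y q.1 q.2, ?_, fun S hv => mem_inBlocks.2 fun p => ?_⟩
  · rw [inMatrix_mulVec, Finset.sum_eq_single ⟨a, α⟩]
    · exact congrArg (z α).mulVec hy
    · intro p _ hp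
      exact (congrArg (z p.2).mulVec (hy0 p hp)).trans (Matrix.mulVec_zero _)
    · simp
  · change y p ∈ S p.1
    by_cases hp : p = ⟨a, α⟩
    · subst hp
      rwa [hy]
    · rw [hy0 p hp]
      exact zero_mem _

theorem inRange_le_iff {z : RepSpace K d} {b : V} {S : Submodule K (Fin (d b) → K)} :
    inRange z b ≤ S ↔ ∀ (a : V) (α : a ⟶ b) (v : Fin (d a) → K), (z α).mulVec v ∈ S := by
  constructor
  · intro h a α v
    obtain ⟨w, hw, -⟩ := exists_inMatrix_mulVec_eq z α v
    exact hw ▸ h ⟨w, rfl⟩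
  · rintro h _ ⟨v, rfl⟩
    rw [Matrix.mulVecLin_apply, inMatrix_mulVec]
    exact sum_mem fun p _ => h p.1 p.2 _

theorem mulVec_mem_inRange (z : RepSpace K d) {a b : V} (α : a ⟶ b) (v : Fin (d a) → K) :
    (z α).mulVec v ∈ inRange z b :=
  inRange_le_iff.1 le_rfl a α v

theorem inRange_le_outKer {z : RepSpace K d}
    (hz : ∀ ⦃a b c : V⦄ (α : a ⟶ b) (β : b ⟶ c), z β * z α = 0) (b : V) :
    inRange z b ≤ outKer z b :=
  inRange_le_iff.2 fun _ α v => mem_outKer.2 fun _ β => by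
    rw [Matrix.mulVec_mulVec, hz, Matrix.zero_mulVec]

theorem finrank_inBlocks (S : ∀ a : V, Submodule K (Fin (d a) → K)) (b : V) :
    finrank K (inBlocks S b) = ∑ p : (Σ a : V, (a ⟶ b)), finrank K (S p.1) := by
  let e : inBlocks S b ≃ₗ[K] ∀ p : (Σ a : V, (a ⟶ b)), S p.1 :=
    { toFun := fun v p => ⟨fun j => v.1 ⟨p, j⟩, mem_inBlocks.1 v.2 p⟩
      invFun := fun v => ⟨fun q => (v q.1).1 q.2, mem_inBlocks.2 fun p => (v p).2⟩
      map_add' := fun _ _ => rfl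
      map_smul' := fun _ _ => rfl
      left_inv := fun _ => rfl
      right_inv := fun _ => rfl }
  rw [e.finrank_eq, Module.finrank_pi_fintype]

theorem inBlocks_le_ker {z : RepSpace K d} {S : ∀ a : V, Submodule K (Fin (d a) → K)}
    (hS : ∀ a, S a ≤ outKer z a) (b : V) :
    inBlocks S b ≤ LinearMap.ker (inMatrix z b).mulVecLin := by
  intro v hv
  rw [LinearMap.mem_ker, Matrix.mulVecLin_apply, inMatrix_mulVec]
  exact Finset.sum_eq_zero fun p _ => mem_outKer.1 (hS p.1 (mem_inBlocks.1 hv p)) _ _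

end Matrices

/-! ### Zariski closure: rank bounds and lines -/

section Closure

variable {K : Type u} [Field K] {V : Type v} [Fintype V] [Quiver.{w} V] [DecidableEq V]
  {I : Ideal (PathAlgebra K V)} {d : V → ℕ}

theorem zariskiClosure_mono {S S' : Set (Rep I d)} (h : S ⊆ S') :
    zariskiClosure S ⊆ zariskiClosure S' :=
  fun _ hz f hf => hz f fun s hs => hf s (h hs)

/-- If the rank at `z` exceeded `r`, some `det (P * A * Q)` of size `r + 1` would equal `1` at `z`,
yet it vanishes on `S`. -/
theorem rank_le_of_mem_zariskiClosure {m : Type x} {n : Type y} [Fintype m] [Fintype n]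
    (A : Matrix m n (MvPolynomial (Coord d) K)) (r : ℕ) {S : Set (Rep I d)} {z : Rep I d}
    (hz : z ∈ zariskiClosure S)
    (hS : ∀ s ∈ S, (A.map (MvPolynomial.eval (coords (s : RepSpace K d)))).rank ≤ r) :
    (A.map (MvPolynomial.eval (coords (z : RepSpace K d)))).rank ≤ r := by
  by_contra h
  obtain ⟨P, Q, hPQ⟩ := exists_mul_mul_eq_one_of_le_rank (Nat.succ_le_of_lt (not_le.1 h))
  let P' : Matrix (Fin (r + 1)) m (MvPolynomial (Coord d) K) := P.map MvPolynomial.C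
  let Q' : Matrix n (Fin (r + 1)) (MvPolynomial (Coord d) K) := Q.map MvPolynomial.C
  have heval : ∀ t : Rep I d, MvPolynomial.eval (coords (t : RepSpace K d)) (P' * A * Q').det =
      (P * A.map (MvPolynomial.eval (coords (t : RepSpace K d))) * Q).det := by
    intro t
    have hP : P'.map (MvPolynomial.eval (coords (t : RepSpace K d))) = P :=
      Matrix.ext fun i j => MvPolynomial.eval_C (P i j)
    have hQ : Q'.map (MvPolynomial.eval (coords (t : RepSpace K d))) = Q :=
      Matrix.ext fun i j => MvPolynomial.eval_C (Q i j)
    rw [RingHom.map_det, RingHom.mapMatrix_apply, Matrix.map_mul, Matrix.map_mul, hP, hQ]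
  have h0 := hz (P' * A * Q').det fun s hs => by
    rw [heval]
    by_contra hdet
    have h1 := Matrix.rank_of_det_ne_zero hdet
    rw [Fintype.card_fin] at h1
    have h2 := (Matrix.rank_mul_le_left
      (P * A.map (MvPolynomial.eval (coords (s : RepSpace K d)))) Q).trans
      ((Matrix.rank_mul_le_right P _).trans (hS s hs))
    omega
  rw [heval, hPQ, Matrix.det_one] at h0
  exact one_ne_zero h0

/-- Restricted to the line `z + c x`, a polynomial vanishing on `S` is a polynomial in `c` with
infinitely many roots, so it also vanishes at `c = 0`. -/
theorem mem_zariskiClosure_of_line [Infinite K] {S : Set (Rep I d)} {z : Rep I d}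
    (x : RepSpace K d)
    (h : ∀ c : K, c ≠ 0 → ∃ s ∈ S, ∀ ⦃a b : V⦄ (α : a ⟶ b),
      (s : RepSpace K d) α = (z : RepSpace K d) α + c • x α) :
    z ∈ zariskiClosure S := by
  intro f hf
  let g : Polynomial K := MvPolynomial.eval₂Hom Polynomial.C (fun q : Coord d =>
    Polynomial.C (coords (z : RepSpace K d) q) + Polynomial.X * Polynomial.C (coords x q)) f
  have hg : ∀ c : K, g.eval c =
      MvPolynomial.eval (fun q => coords (z : RepSpace K d) q + c * coords x q) f := by
    intro c
    rw [← Polynomial.coe_evalRingHom, ← RingHom.comp_apply]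
    refine RingHom.congr_fun ?_ f
    refine MvPolynomial.ringHom_ext (fun r => ?_) (fun q => ?_)
    · simp
    · simp only [RingHom.comp_apply, MvPolynomial.eval₂Hom_X', Polynomial.coe_evalRingHom,
        Polynomial.eval_add, Polynomial.eval_mul, Polynomial.eval_C, Polynomial.eval_X,
        MvPolynomial.eval_X]
  have h0 : g = 0 := by
    refine Polynomial.eq_zero_of_infinite_isRoot g ((Set.finite_singleton (0 : K)).infinite_compl.mono
      fun c hc => ?_)
    obtain ⟨s, hs, hsz⟩ := h c hc
    have := hf s hs
    rw [Set.mem_ofPred_eq, Polynomial.IsRoot, hg, ← this]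
    congr 2
    ext q
    simp [coords, hsz]
  simpa [h0] using (hg 0).symm

variable [∀ a b : V, Fintype (a ⟶ b)]

theorem rank_inMatrix_le_of_mem_zariskiClosure (b : V) (r : ℕ) {S : Set (Rep I d)} {z : Rep I d}
    (hz : z ∈ zariskiClosure S) (hS : ∀ s ∈ S, (inMatrix (s : RepSpace K d) b).rank ≤ r) :
    (inMatrix (z : RepSpace K d) b).rank ≤ r := by
  let A : Matrix (Fin (d b)) (InIndex d b) (MvPolynomial (Coord d) K) :=
    fun i q => MvPolynomial.X ⟨q.1.1, b, q.1.2, i, q.2⟩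
  have hA : ∀ t : Rep I d, A.map (MvPolynomial.eval (coords (t : RepSpace K d))) =
      inMatrix (t : RepSpace K d) b := fun t => by
    refine Matrix.ext fun i q => ?_
    rw [Matrix.map_apply, MvPolynomial.eval_X]
    rfl
  simp only [← hA] at hS ⊢
  exact rank_le_of_mem_zariskiClosure A r hz hS

theorem rank_outMatrix_le_of_mem_zariskiClosure (b : V) (r : ℕ) {S : Set (Rep I d)} {z : Rep I d}
    (hz : z ∈ zariskiClosure S) (hS : ∀ s ∈ S, (outMatrix (s : RepSpace K d) b).rank ≤ r) :
    (outMatrix (z : RepSpace K d) b).rank ≤ r := by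
  let A : Matrix (OutIndex d b) (Fin (d b)) (MvPolynomial (Coord d) K) :=
    fun q j => MvPolynomial.X ⟨b, q.1.1, q.1.2, q.2, j⟩
  have hA : ∀ t : Rep I d, A.map (MvPolynomial.eval (coords (t : RepSpace K d))) =
      outMatrix (t : RepSpace K d) b := fun t => by
    refine Matrix.ext fun q j => ?_
    rw [Matrix.map_apply, MvPolynomial.eval_X]
    rfl
  simp only [← hA] at hS ⊢
  exact rank_le_of_mem_zariskiClosure A r hz hS

end Closure


/-! ### The top of the module of a point -/

section Tops

variable {K : Type u} [Field K] {V : Type v} [Fintype V] [Quiver.{w} V] [DecidableEq V]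
  {I : Ideal (PathAlgebra K V)} [I.IsTwoSided] {d : V → ℕ}

/-- The submodule given by a family of subspaces which contain all images of arrows. -/
def submoduleOfPieces (z : Rep I d) (S : ∀ b : V, Submodule K (Fin (d b) → K))
    (hS : ∀ (a b : V) (α : a ⟶ b) (v : Fin (d a) → K), ((z : RepSpace K d) α).mulVec v ∈ S b) :
    Submodule (PathAlgebra K V ⧸ I) (RepModule z) :=
  submoduleOfGenerators (⨅ b, (S b).comap (component z b))
    (fun i m hm => by
      rw [Submodule.mem_iInf] at hm ⊢
      intro b
      rw [Submodule.mem_comap, qVertex_smul]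
      by_cases hb : b = i
      · subst hb
        rw [component_incl]
        exact hm b
      · rw [component_incl_of_ne z hb]
        exact zero_mem _)
    (fun a c α m hm => by
      rw [Submodule.mem_iInf]
      intro b
      rw [Submodule.mem_comap, qArrow_smul]
      by_cases hb : b = c
      · subst hb
        rw [component_incl]
        exact hS a b α _
      · rw [component_incl_of_ne z hb]
        exact zero_mem _)

theorem mem_submoduleOfPieces {z : Rep I d} {S : ∀ b : V, Submodule K (Fin (d b) → K)}
    {hS : ∀ (a b : V) (α : a ⟶ b) (v : Fin (d a) → K), ((z : RepSpace K d) α).mulVec v ∈ S b}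
    {m : RepModule z} : m ∈ submoduleOfPieces z S hS ↔ ∀ b, component z b m ∈ S b :=
  Submodule.mem_iInf (fun b => (S b).comap (component z b))

theorem piece_submoduleOfPieces (z : Rep I d) (S : ∀ b : V, Submodule K (Fin (d b) → K))
    (hS : ∀ (a b : V) (α : a ⟶ b) (v : Fin (d a) → K), ((z : RepSpace K d) α).mulVec v ∈ S b)
    (b : V) : piece (submoduleOfPieces z S hS) b = S b := by
  ext v
  rw [mem_piece, mem_submoduleOfPieces]
  refine ⟨fun h => by simpa only [component_incl] using h b, fun h c => ?_⟩
  by_cases hc : c = b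
  · subst hc
    rwa [component_incl]
  · rw [component_incl_of_ne z hc]
    exact zero_mem _

theorem qArrow_smul_mem_submoduleOfPieces (z : Rep I d)
    (S : ∀ b : V, Submodule K (Fin (d b) → K))
    (hS : ∀ (a b : V) (α : a ⟶ b) (v : Fin (d a) → K), ((z : RepSpace K d) α).mulVec v ∈ S b)
    (a b : V) (α : a ⟶ b) (m : RepModule z) : qArrow I α • m ∈ submoduleOfPieces z S hS := by
  rw [qArrow_smul, ← mem_piece, piece_submoduleOfPieces]
  exact hS a b α _

variable [∀ a b : V, Fintype (a ⟶ b)]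

theorem piece_radical (hI : IsAdmissible I) (z : Rep I d) (b : V) :
    piece (Ring.jacobson (PathAlgebra K V ⧸ I) • (⊤ : Submodule _ (RepModule z))) b =
      inRange (z : RepSpace K d) b := by
  apply le_antisymm
  · let N := submoduleOfPieces z (fun b => inRange (z : RepSpace K d) b)
      (fun _ _ α v => mulVec_mem_inRange _ α v)
    have hN : Ring.jacobson (PathAlgebra K V ⧸ I) • (⊤ : Submodule _ (RepModule z)) ≤ N :=
      (radical_le_iff hI).2 (qArrow_smul_mem_submoduleOfPieces z _ _)
    intro v hv
    have hv' : v ∈ piece N b := hN hv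
    rwa [piece_submoduleOfPieces] at hv'
  · rw [inRange_le_iff]
    intro a α v
    rw [mem_piece]
    have := qArrow_smul_mem_radical hI α (incl z a v)
    rwa [qArrow_smul, component_incl] at this

theorem modIso_top_iff (hI : IsAdmissible I) (z y : Rep I d) :
    ModIso (PathAlgebra K V ⧸ I) (ModTop (PathAlgebra K V ⧸ I) (RepModule z))
        (ModTop (PathAlgebra K V ⧸ I) (RepModule y)) ↔
      ∀ b, finrank K (inRange (z : RepSpace K d) b) = finrank K (inRange (y : RepSpace K d) b) := by
  constructor
  · rintro ⟨e⟩ b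
    rw [← piece_radical hI, ← piece_radical hI]
    exact finrank_piece_eq_of_equiv e b
  · intro h
    refine modIso_quotient_of_finrank_piece_eq (fun _ _ α m => qArrow_smul_mem_radical hI α m)
      (fun _ _ α m => qArrow_smul_mem_radical hI α m) fun b => ?_
    rw [piece_radical hI, piece_radical hI]
    exact h b

end Tops

/-! ### Splitting off a semisimple summand -/

section Decomposition

variable {K : Type u} [Field K] {V : Type v} [Fintype V] [Quiver.{w} V]
  {I : Ideal (PathAlgebra K V)} [I.IsTwoSided]

variable (I) in
/-- The module `X` has a submodule between its radical and its socle with quotient `T`. -/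
def HasSocleQuotient (X : Type x) [AddCommGroup X] [Module (PathAlgebra K V ⧸ I) X]
    (T : Type y) [AddCommGroup T] [Module (PathAlgebra K V ⧸ I) T] : Prop :=
  ∃ S : Submodule (PathAlgebra K V ⧸ I) X,
    (∀ (a b : V) (α : a ⟶ b) (m : X), qArrow I α • m ∈ S) ∧
    (∀ (a b : V) (α : a ⟶ b), ∀ m ∈ S, qArrow I α • m = 0) ∧
    ModIso (PathAlgebra K V ⧸ I) (X ⧸ S) T

variable {X : Type x} [AddCommGroup X] [Module (PathAlgebra K V ⧸ I) X]
  {T : Type y} [AddCommGroup T] [Module (PathAlgebra K V ⧸ I) T]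

theorem HasSocleQuotient.congr {Y : Type*} [AddCommGroup Y] [Module (PathAlgebra K V ⧸ I) Y]
    (e : X ≃ₗ[PathAlgebra K V ⧸ I] Y) (h : HasSocleQuotient I X T) : HasSocleQuotient I Y T := by
  obtain ⟨S, h1, h2, ⟨f⟩⟩ := h
  refine ⟨S.map (e : X →ₗ[PathAlgebra K V ⧸ I] Y), fun a b α m => ?_, ?_,
    ⟨(Submodule.Quotient.equiv S _ e rfl).symm ≪≫ₗ f⟩⟩
  · rw [Submodule.mem_map_equiv, map_smul]
    exact h1 a b α _
  · rintro a b α _ ⟨m, hm, rfl⟩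
    rw [← map_smul, h2 a b α m hm, map_zero]

/-- `X / N` is semisimple, so a complement exists there and can be pulled back to `X`. -/
theorem exists_isCompl_Ici {N : Submodule (PathAlgebra K V ⧸ I) X}
    (hN : ∀ (a b : V) (α : a ⟶ b) (m : X), qArrow I α • m ∈ N)
    {S : Submodule (PathAlgebra K V ⧸ I) X} (hS : N ≤ S) :
    ∃ S' : Submodule (PathAlgebra K V ⧸ I) X, S ⊓ S' = N ∧ S ⊔ S' = ⊤ := by
  have := isSemisimpleModule_of_qArrow_smul_eq_zero (qArrow_smul_quotient_eq_zero hN)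
  obtain ⟨C, hC⟩ := exists_isCompl (S.map N.mkQ)
  refine ⟨C.comap N.mkQ, ?_, ?_⟩
  · have h := congrArg (Submodule.comap N.mkQ) hC.inf_eq_bot
    rwa [Submodule.comap_inf, Submodule.comap_map_mkQ, sup_eq_right.2 hS, ← LinearMap.ker,
      Submodule.ker_mkQ] at h
  · rw [eq_top_iff]
    intro m _
    obtain ⟨_, ⟨n, hn, rfl⟩, c, hc, h⟩ :=
      Submodule.mem_sup.1 (hC.sup_eq_top.ge (Submodule.mem_top (x := N.mkQ m)))
    refine Submodule.mem_sup.2 ⟨n, hn, m - n, ?_, by abel⟩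
    rw [Submodule.mem_comap, map_sub, ← h, add_sub_cancel_left]
    exact hc

theorem modIso_top_quotient {X' S : Submodule (PathAlgebra K V ⧸ I) X} (h : X' ⊔ S = ⊤)
    (hS : ∀ v : X', (v : X) ∈ S →
      v ∈ Ring.jacobson (PathAlgebra K V ⧸ I) • (⊤ : Submodule (PathAlgebra K V ⧸ I) X'))
    (hS' : ∀ v ∈ Ring.jacobson (PathAlgebra K V ⧸ I) • (⊤ : Submodule (PathAlgebra K V ⧸ I) X'),
      (v : X) ∈ S) :
    ModIso (PathAlgebra K V ⧸ I) (ModTop (PathAlgebra K V ⧸ I) X') (X ⧸ S) := by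
  let g : X' →ₗ[PathAlgebra K V ⧸ I] X ⧸ S := S.mkQ ∘ₗ X'.subtype
  have hg : Function.Surjective g := by
    intro m
    obtain ⟨m, rfl⟩ := S.mkQ_surjective m
    obtain ⟨v, hv, s, hs, rfl⟩ := Submodule.mem_sup.1 (h.ge (Submodule.mem_top (x := m)))
    refine ⟨⟨v, hv⟩, ?_⟩
    rw [map_add, S.mkQ_apply s, (Submodule.Quotient.mk_eq_zero S).2 hs, add_zero]
    rfl
  have hk : LinearMap.ker g =
      Ring.jacobson (PathAlgebra K V ⧸ I) • (⊤ : Submodule (PathAlgebra K V ⧸ I) X') := by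
    ext v
    exact (Submodule.Quotient.mk_eq_zero S).trans ⟨hS v, hS' v⟩
  exact ⟨Submodule.quotEquivOfEq _ _ hk.symm ≪≫ₗ g.quotKerEquivOfSurjective hg⟩

theorem qArrow_smul_eq_zero_of_mem_radical (hI : IsAdmissible I)
    (hJ : ∀ r ∈ Ring.jacobson (PathAlgebra K V ⧸ I), ∀ s ∈ Ring.jacobson (PathAlgebra K V ⧸ I),
      r * s = 0) {a b : V} (α : a ⟶ b) {m : X}
    (hm : m ∈ Ring.jacobson (PathAlgebra K V ⧸ I) • (⊤ : Submodule (PathAlgebra K V ⧸ I) X)) :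
    qArrow I α • m = 0 := by
  induction hm using Submodule.smul_induction_on' with
  | smul r hr m _ => rw [smul_smul, hJ _ (qArrow_mem_jacobson I hI α) _ hr, zero_smul]
  | add m _ n _ h h' => rw [smul_add, h, h', add_zero]

/-- Given `S`, let `U` be a complement of `J X` in the semisimple module `S`, and `X'` a complement
of `S` relative to `J X`. Then `X = X' ⊕ U`. Conversely `S = J X' ⊕ U` works; the arrows kill its
first summand because `J² = 0`. -/
theorem hasSocleQuotient_iff (hI : IsAdmissible I)
    (hJ : ∀ r ∈ Ring.jacobson (PathAlgebra K V ⧸ I), ∀ s ∈ Ring.jacobson (PathAlgebra K V ⧸ I),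
      r * s = 0) :
    HasSocleQuotient I X T ↔
      ∃ X' U : Submodule (PathAlgebra K V ⧸ I) X, IsCompl X' U ∧
        ModIso (PathAlgebra K V ⧸ I) (ModTop (PathAlgebra K V ⧸ I) X') T ∧
        IsSemisimpleModule (PathAlgebra K V ⧸ I) U := by
  constructor
  · rintro ⟨S, h1, h2, ⟨f⟩⟩
    let N := Ring.jacobson (PathAlgebra K V ⧸ I) • (⊤ : Submodule (PathAlgebra K V ⧸ I) X)
    have hN : ∀ (a b : V) (α : a ⟶ b) (m : X), qArrow I α • m ∈ N :=
      fun _ _ α m => qArrow_smul_mem_radical hI α m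
    have hNS : N ≤ S := (radical_le_iff hI).2 h1
    have hSs : IsSemisimpleModule (PathAlgebra K V ⧸ I) S :=
      isSemisimpleModule_of_qArrow_smul_eq_zero fun a b α m => Subtype.ext (h2 a b α m m.2)
    obtain ⟨U', hU'⟩ := exists_isCompl (N.comap S.subtype)
    obtain ⟨X', hX, hX'⟩ := exists_isCompl_Ici hN hNS
    let U := U'.map S.subtype
    have hUS : U ≤ S := Submodule.map_subtype_le S U'
    have hNU : Disjoint N U := by
      rw [Submodule.disjoint_def]
      rintro _ hm ⟨m, hmU, rfl⟩
      have := Submodule.disjoint_def.1 hU'.disjoint m hm hmU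
      rw [this, map_zero]
    have hNUS : S ≤ N ⊔ U := fun m hm => by
      obtain ⟨n, hn, u, hu, h⟩ :=
        Submodule.mem_sup.1 (hU'.sup_eq_top.ge (Submodule.mem_top (x := (⟨m, hm⟩ : S))))
      exact Submodule.mem_sup.2 ⟨n, hn, u, ⟨u, hu, rfl⟩, congrArg Subtype.val h⟩
    have hNX : N ≤ X' := hX.ge.trans inf_le_right
    have hc : IsCompl X' U := by
      constructor
      · rw [disjoint_iff_inf_le]
        have h : X' ⊓ U ≤ N := by
          rw [← hX, inf_comm]
          exact inf_le_inf_right _ hUS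
        exact (le_inf h inf_le_right).trans hNU.le_bot
      · rw [codisjoint_iff_le_sup, ← hX']
        exact sup_le (hNUS.trans (sup_le_sup_right hNX U)) le_sup_left
    have hU0 : ∀ (a b : V) (α : a ⟶ b), ∀ u ∈ U, qArrow I α • u = 0 :=
      fun a b α u hu => h2 a b α u (hUS hu)
    -- Arrows kill `U`, so `J X` comes from `X'` alone. Hence `S ∩ X' = J X'`, and `X'` has top `X /
    -- S`.
    have hrad : N ≤ (Ring.jacobson (PathAlgebra K V ⧸ I) •
        (⊤ : Submodule (PathAlgebra K V ⧸ I) X')).map X'.subtype := by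
      refine (radical_le_iff hI).2 fun a b α m => ?_
      obtain ⟨v, hv, u, hu, rfl⟩ :=
        Submodule.mem_sup.1 (hc.sup_eq_top.ge (Submodule.mem_top (x := m)))
      rw [smul_add, hU0 a b α u hu, add_zero]
      exact ⟨_, qArrow_smul_mem_radical hI α ⟨v, hv⟩, rfl⟩
    obtain ⟨g⟩ := modIso_top_quotient (X' := X') (S := S) (by rw [sup_comm, hX'])
      (fun v hv => by
        obtain ⟨v', hv', h⟩ := hrad (hX.le ⟨hv, v.2⟩)
        rwa [← Subtype.ext h])
      (fun v hv => by
        have : Ring.jacobson (PathAlgebra K V ⧸ I) • ⊤ ≤ S.comap X'.subtype :=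
          (radical_le_iff hI).2 fun a b α m => h1 a b α m
        exact this hv)
    exact ⟨X', U, hc, ⟨g ≪≫ₗ f⟩, isSemisimpleModule_of_qArrow_smul_eq_zero
      fun a b α u => Subtype.ext (hU0 a b α u u.2)⟩
  · rintro ⟨X', U, hc, ⟨f⟩, hU⟩
    have hU0 : ∀ (a b : V) (α : a ⟶ b), ∀ u ∈ U, qArrow I α • u = 0 := fun a b α u hu =>
      congrArg Subtype.val (qArrow_smul_eq_zero_of_isSemisimpleModule hI α (⟨u, hu⟩ : U))
    let R := (Ring.jacobson (PathAlgebra K V ⧸ I) •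
        (⊤ : Submodule (PathAlgebra K V ⧸ I) X')).map X'.subtype
    have hRX : R ≤ X' := Submodule.map_subtype_le _ _
    obtain ⟨g⟩ := modIso_top_quotient (X' := X') (S := R ⊔ U)
      (by rw [eq_top_iff, ← hc.sup_eq_top]; exact sup_le_sup_left le_sup_right X')
      (fun v hv => by
        obtain ⟨n, hn, u, hu, h⟩ := Submodule.mem_sup.1 hv
        have huX : u ∈ X' := by
          rw [eq_sub_of_add_eq' h]
          exact X'.sub_mem v.2 (hRX hn)
        rw [Submodule.disjoint_def.1 hc.disjoint u huX hu, add_zero] at h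
        obtain ⟨n', hn', rfl⟩ := hn
        rwa [← Subtype.ext h])
      (fun v hv => Submodule.mem_sup_left ⟨v, hv, rfl⟩)
    refine ⟨R ⊔ U, fun a b α m => ?_, fun a b α m hm => ?_, ⟨g.symm ≪≫ₗ f⟩⟩
    · obtain ⟨v, hv, u, hu, rfl⟩ :=
        Submodule.mem_sup.1 (hc.sup_eq_top.ge (Submodule.mem_top (x := m)))
      rw [smul_add, hU0 a b α u hu, add_zero]
      exact Submodule.mem_sup_left ⟨_, qArrow_smul_mem_radical hI α ⟨v, hv⟩, rfl⟩
    · obtain ⟨_, ⟨n, hn, rfl⟩, u, hu, rfl⟩ := Submodule.mem_sup.1 hm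
      rw [smul_add, hU0 a b α u hu, add_zero, ← map_smul,
        qArrow_smul_eq_zero_of_mem_radical hI hJ α hn, map_zero]

end Decomposition


/-! ### Points of the closure and degenerations -/

section Degeneration

variable {K : Type u} [Field K] {V : Type v} [Fintype V] [Quiver.{w} V] [DecidableEq V]
  {I : Ideal (PathAlgebra K V)} [I.IsTwoSided] {d : V → ℕ}

theorem modIso_of_mem_glOrbit {m z : Rep I d} (h : z ∈ glOrbit m) :
    ModIso (PathAlgebra K V ⧸ I) (RepModule z) (RepModule m) := by
  obtain ⟨g, hg⟩ := h
  let θ : ∀ b, (Fin (d b) → K) ≃ₗ[K] (Fin (d b) → K) := fun b =>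
    LinearEquiv.ofLinearMap (Matrix.toLin' (g b).val) (Matrix.toLin' ((g b)⁻¹).val)
      (by rw [← Matrix.toLin'_mul, Units.mul_inv, Matrix.toLin'_one])
      (by rw [← Matrix.toLin'_mul, Units.inv_mul, Matrix.toLin'_one])
  let Θ : RepModule m ≃ₗ[K] RepModule z := LinearEquiv.piCongrRight θ
  have hc : ∀ b x, component z b (Θ x) = (g b).val.mulVec (component m b x) := fun b x => rfl
  have hi : ∀ b v, Θ (incl m b v) = incl z b ((g b).val.mulVec v) := fun b v => by
    refine repModule_ext fun c => ?_
    rw [hc]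
    by_cases hcb : c = b
    · subst hcb
      rw [component_incl, component_incl]
    · rw [component_incl_of_ne m hcb, component_incl_of_ne z hcb, Matrix.mulVec_zero]
  refine ⟨(equivOfGenerators Θ (fun i x => ?_) (fun a b α x => ?_)).symm⟩
  · rw [qVertex_smul, qVertex_smul, hi, hc]
  · rw [qArrow_smul, qArrow_smul, hi, hc, hg, Matrix.mulVec_mulVec, Matrix.mulVec_mulVec,
      Matrix.mul_assoc, Units.inv_mul, Matrix.mul_one]

/-- Isomorphic modules have isomorphic tops. -/
theorem modIso_top_of_equiv {Λ : Type u} [Ring Λ] {X : Type v} [AddCommGroup X] [Module Λ X]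
    {Y : Type w} [AddCommGroup Y] [Module Λ Y] (e : X ≃ₗ[Λ] Y) :
    ModIso Λ (ModTop Λ X) (ModTop Λ Y) :=
  ⟨Submodule.Quotient.equiv _ _ e (by
    rw [Submodule.map_smul'', Submodule.map_top, LinearEquiv.range])⟩

variable {T : Type y} [AddCommGroup T] [Module (PathAlgebra K V ⧸ I) T]

theorem glOrbit_subset_repTop {m : Rep I d} (hm : m ∈ RepTop I d T) :
    glOrbit m ⊆ RepTop I d T := by
  intro z hz
  obtain ⟨e⟩ := modIso_of_mem_glOrbit hz
  obtain ⟨e'⟩ := modIso_top_of_equiv e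
  obtain ⟨f⟩ := hm
  exact ⟨e' ≪≫ₗ f⟩

variable [∀ a b : V, Fintype (a ⟶ b)]

theorem hasSocleQuotient_of_mem_zariskiClosure (hI : IsAdmissible I)
    (hJ : ∀ r ∈ Ring.jacobson (PathAlgebra K V ⧸ I), ∀ s ∈ Ring.jacobson (PathAlgebra K V ⧸ I),
      r * s = 0) (hT : IsRealizable I d T) {z : Rep I d}
    (hz : z ∈ zariskiClosure (RepTop I d T)) : HasSocleQuotient I (RepModule z) T := by
  obtain ⟨y, ⟨fy⟩⟩ := hT
  have hs : ∀ s ∈ RepTop I d T, ∀ b,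
      finrank K (inRange (s : RepSpace K d) b) = finrank K (inRange (y : RepSpace K d) b) := by
    rintro s ⟨fs⟩
    exact (modIso_top_iff hI s y).1 ⟨fs ≪≫ₗ fy.symm⟩
  have hle : ∀ (s : Rep I d) b, inRange (s : RepSpace K d) b ≤ outKer (s : RepSpace K d) b :=
    fun s b => inRange_le_outKer (fun _ _ _ α β => mul_eq_zero_of_mem_rep hI hJ s α β) b
  have hS : ∀ b, ∃ S : Submodule K (Fin (d b) → K), inRange (z : RepSpace K d) b ≤ S ∧
      S ≤ outKer (z : RepSpace K d) b ∧ finrank K S = finrank K (inRange (y : RepSpace K d) b) := by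
    intro b
    refine exists_le_le_finrank_eq (hle z b)
      (rank_inMatrix_le_of_mem_zariskiClosure b _ hz fun s hs' => (hs s hs' b).le) ?_
    -- A lower bound for the kernel is not visibly a closed condition on its own; it is expressed as
    -- an upper bound for the outgoing rank.
    have h1 := rank_outMatrix_le_of_mem_zariskiClosure b
      (d b - finrank K (inRange (y : RepSpace K d) b)) hz fun s hs' => by
        have h2 := finrank_outKer_add_rank (s : RepSpace K d) b
        have h3 := Submodule.finrank_mono (hle s b)
        rw [hs s hs' b] at h3
        omega
    have h2 := finrank_outKer_add_rank (z : RepSpace K d) b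
    have h3 := Submodule.finrank_le (inRange (y : RepSpace K d) b)
    rw [Module.finrank_fin_fun] at h3
    omega
  choose S hS1 hS2 hS3 using hS
  have hzS : ∀ (a b : V) (α : a ⟶ b) (v : Fin (d a) → K),
      ((z : RepSpace K d) α).mulVec v ∈ S b :=
    fun a b α v => hS1 b (mulVec_mem_inRange _ α v)
  obtain ⟨f⟩ := modIso_quotient_of_finrank_piece_eq (z := z) (y := y)
    (N := submoduleOfPieces z S hzS)
    (N' := Ring.jacobson (PathAlgebra K V ⧸ I) • ⊤)
    (qArrow_smul_mem_submoduleOfPieces z S hzS) (fun _ _ α m => qArrow_smul_mem_radical hI α m)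
    (fun b => by rw [piece_submoduleOfPieces, piece_radical hI, hS3])
  refine ⟨submoduleOfPieces z S hzS, qArrow_smul_mem_submoduleOfPieces z S hzS,
    fun a b α m hm => ?_, ⟨f ≪≫ₗ fy⟩⟩
  rw [qArrow_smul, mem_outKer.1 (hS2 a (mem_submoduleOfPieces.1 hm a)), map_zero]

theorem exists_mem_zariskiClosure_glOrbit [Infinite K] (hI : IsAdmissible I)
    (hJ : ∀ r ∈ Ring.jacobson (PathAlgebra K V ⧸ I), ∀ s ∈ Ring.jacobson (PathAlgebra K V ⧸ I),
      r * s = 0) (hT : IsRealizable I d T) {z : Rep I d}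
    (hz : HasSocleQuotient I (RepModule z) T) :
    ∃ m ∈ RepTop I d T, z ∈ zariskiClosure (glOrbit m) := by
  classical
  obtain ⟨y, ⟨fy⟩⟩ := hT
  obtain ⟨N, hN1, hN2, ⟨fN⟩⟩ := hz
  let S : ∀ b : V, Submodule K (Fin (d b) → K) := fun b => piece N b
  have hSy : ∀ b, finrank K (S b) = finrank K (inRange (y : RepSpace K d) b) := fun b => by
    rw [← piece_radical hI]
    exact finrank_piece_eq_of_equiv (fN ≪≫ₗ fy.symm) b
  have hzS : ∀ b, inRange (z : RepSpace K d) b ≤ S b := fun b => inRange_le_iff.2 fun a α v => by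
    have := hN1 a b α (incl z a v)
    rwa [qArrow_smul, component_incl] at this
  have hSz : ∀ b, S b ≤ outKer (z : RepSpace K d) b := fun b v hv => mem_outKer.2 fun c β => by
    have := hN2 b c β _ (mem_piece.1 hv)
    rw [qArrow_smul, component_incl] at this
    rw [← component_incl z c (((z : RepSpace K d) β).mulVec v), this, map_zero]
  -- Only the dimensions of the `S b` matter, and they agree with those of the images at `y`. For
  -- `y` the inequality is rank-nullity, as the blocks of images lie in the kernel of the incoming
  -- matrix.
  have hdim : ∀ b, finrank K (S b) + finrank K (inBlocks S b) ≤ finrank K (InIndex d b → K) := by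
    intro b
    have h1 : finrank K (inBlocks S b) =
        finrank K (inBlocks (inRange (y : RepSpace K d)) b) := by
      rw [finrank_inBlocks, finrank_inBlocks]
      exact Finset.sum_congr rfl fun p _ => hSy p.1
    have h2 := Submodule.finrank_mono (inBlocks_le_ker (fun a => inRange_le_outKer
      (fun _ _ _ α β => mul_eq_zero_of_mem_rep hI hJ y α β) a) b)
    have h3 : finrank K (inRange (y : RepSpace K d) b) +
        finrank K (LinearMap.ker (inMatrix (y : RepSpace K d) b).mulVecLin) = _ :=
      LinearMap.finrank_range_add_finrank_ker _
    rw [h1, hSy]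
    omega
  choose φ π hππ hπz hπφ hπS hφ0 hφS using fun b =>
    exists_complementary_map (inMatrix (z : RepSpace K d) b).mulVecLin
      (inBlocks_le_ker hSz b) (hzS b) (hdim b)
  let x : RepSpace K d := fun a b α i j => LinearMap.toMatrix' (φ b) i ⟨⟨a, α⟩, j⟩
  have hx : ∀ b, inMatrix x b = LinearMap.toMatrix' (φ b) := fun b => rfl
  have hxlin : ∀ b, (inMatrix x b).mulVecLin = φ b := fun b => by
    rw [hx, ← Matrix.toLin'_apply', Matrix.toLin'_toMatrix']
  have hxS : ∀ b, inRange x b ≤ S b := by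
    rintro b _ ⟨v, rfl⟩
    rw [hxlin, ← hπφ]
    exact hπS b ⟨_, rfl⟩
  have hSx : ∀ b, S b ≤ outKer x b := fun b v hv => mem_outKer.2 fun c β => by
    obtain ⟨w, hw, hwS⟩ := exists_inMatrix_mulVec_eq x β v
    rw [← hw, ← Matrix.mulVecLin_apply, hxlin]
    exact hφ0 c (hwS S hv)
  have hπx : ∀ {a b : V} (α : a ⟶ b), LinearMap.toMatrix' (π b) * x α = x α := by
    intro a b α
    refine Matrix.toLin'.injective (LinearMap.ext fun v => ?_)
    obtain ⟨w, hw, -⟩ := exists_inMatrix_mulVec_eq x α v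
    rw [Matrix.toLin'_mul, Matrix.toLin'_toMatrix', LinearMap.comp_apply, Matrix.toLin'_apply,
      ← hw, ← Matrix.mulVecLin_apply, hxlin]
    exact LinearMap.congr_fun (hπφ b) w
  have hπz' : ∀ {a b : V} (α : a ⟶ b),
      LinearMap.toMatrix' (π b) * (z : RepSpace K d) α = 0 := by
    intro a b α
    refine Matrix.toLin'.injective (LinearMap.ext fun v => ?_)
    obtain ⟨w, hw, -⟩ := exists_inMatrix_mulVec_eq (z : RepSpace K d) α v
    rw [Matrix.toLin'_mul, Matrix.toLin'_toMatrix', LinearMap.comp_apply, Matrix.toLin'_apply,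
      ← hw, ← Matrix.mulVecLin_apply]
    simpa using LinearMap.congr_fun (hπz b) w
  have hkill : ∀ {t : RepSpace K d}, (∀ b, S b ≤ outKer t b) → ∀ {a b : V} (α : a ⟶ b),
      t α * LinearMap.toMatrix' (π a) = 0 := by
    intro t ht a b α
    refine Matrix.toLin'.injective (LinearMap.ext fun v => ?_)
    rw [Matrix.toLin'_mul, Matrix.toLin'_toMatrix', LinearMap.comp_apply, Matrix.toLin'_apply,
      map_zero]
    exact mem_outKer.1 (ht a (hπS a ⟨v, rfl⟩)) b α
  -- For every `c`, both the image and the vanishing conditions relative to `S` hold along this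
  -- line, so it stays inside the variety.
  let t : K → RepSpace K d := fun c a b α => (z : RepSpace K d) α + c • x α
  have htmul : ∀ c (a b : V) (α : a ⟶ b) (v : Fin (d a) → K),
      (t c α).mulVec v = ((z : RepSpace K d) α).mulVec v + c • (x α).mulVec v := fun c a b α v => by
    rw [Matrix.add_mulVec, Matrix.smul_mulVec]
  have htker : ∀ c b, S b ≤ outKer (t c) b := fun c b v hv => mem_outKer.2 fun e β => by
    rw [htmul, mem_outKer.1 (hSz b hv), mem_outKer.1 (hSx b hv), smul_zero, add_zero]
  have htran : ∀ c b, inRange (t c) b ≤ S b := fun c b => inRange_le_iff.2 fun a α v => by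
    rw [htmul]
    exact add_mem (hzS b (mulVec_mem_inRange _ α v))
      ((S b).smul_mem c (hxS b (mulVec_mem_inRange _ α v)))
  have htI : ∀ c, t c ∈ Rep I d := fun c => mem_rep_of_mul_eq_zero hI fun a b e α β => by
    refine Matrix.toLin'.injective (LinearMap.ext fun v => ?_)
    rw [Matrix.toLin'_apply, ← Matrix.mulVec_mulVec, map_zero]
    exact mem_outKer.1 (htker c b (htran c b (mulVec_mem_inRange _ α v))) e β
  have hπ2 : ∀ b, LinearMap.toMatrix' (π b) * LinearMap.toMatrix' (π b) =
      LinearMap.toMatrix' (π b) := fun b => by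
    rw [← LinearMap.toMatrix'_comp, hππ]
  -- As `π b` is idempotent, `1 + (c - 1) π` acts as `c` on its range and as `1` on its kernel.
  have hunit : ∀ b (c e : K), c * e = 1 →
      (1 + (c - 1) • LinearMap.toMatrix' (π b)) * (1 + (e - 1) • LinearMap.toMatrix' (π b)) = 1 := by
    intro b c e hce
    rw [add_mul, mul_add, mul_add, one_mul, mul_one, smul_mul_smul_comm, hπ2, one_mul, add_assoc,
      ← add_smul, ← add_smul, show (e - 1) + ((c - 1) + (c - 1) * (e - 1)) = c * e - 1 by ring,
      hce, sub_self, zero_smul, add_zero]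
  -- At `c = 1` the incoming image is all of `S b`, which has the dimension required for the top
  -- `T`.
  have hm : (⟨t 1, htI 1⟩ : Rep I d) ∈ RepTop I d T := by
    obtain ⟨e⟩ := (modIso_top_iff hI ⟨t 1, htI 1⟩ y).2 fun b => by
      rw [← hSy, ← hφS b]
      have : (inMatrix (t 1) b).mulVecLin = (inMatrix (z : RepSpace K d) b).mulVecLin + φ b := by
        rw [← hxlin, ← Matrix.mulVecLin_add]
        congr 1
        ext i q
        simp [t, inMatrix]
      rw [← this]
    exact ⟨e ≪≫ₗ fy⟩
  refine ⟨_, hm, mem_zariskiClosure_of_line x fun c hc => ⟨⟨t c, htI c⟩,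
    ⟨fun b => ⟨_, _, hunit b c c⁻¹ (mul_inv_cancel₀ hc), hunit b c⁻¹ c (inv_mul_cancel₀ hc)⟩,
      fun a b α => ?_⟩, fun a b α => rfl⟩⟩
  -- On the left, the conjugating matrix fixes `z α` and scales `x α` by `c`. On the right, the
  -- inverse has no effect, because `t c α` kills `S a`, which contains the range of `π a`.
  change t c α = (1 + (c - 1) • LinearMap.toMatrix' (π b)) * (t 1 α) *
    (1 + (c⁻¹ - 1) • LinearMap.toMatrix' (π a))
  have h1 : (1 + (c - 1) • LinearMap.toMatrix' (π b)) * (t 1 α) = t c α := by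
    change (1 + (c - 1) • LinearMap.toMatrix' (π b)) * ((z : RepSpace K d) α + (1 : K) • x α) =
      (z : RepSpace K d) α + c • x α
    rw [Matrix.add_mul, Matrix.one_mul, Matrix.smul_mul, one_smul, Matrix.mul_add, hπz', hπx,
      zero_add, add_assoc, sub_smul, one_smul,
      add_sub_cancel]
  rw [h1, Matrix.mul_add, Matrix.mul_one, Matrix.mul_smul, hkill (htker c), smul_zero, add_zero]

end Degeneration

/-! ### The dimension vector of a degeneration -/

section Dimension

variable {K : Type u} [Field K] {V : Type v} [Fintype V] [Quiver.{w} V] [DecidableEq V]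
  {I : Ideal (PathAlgebra K V)} [I.IsTwoSided]

/-- `IsDegeneration` quantifies over its own dimension vector; the module of `m` forces it to be
`d`. -/
theorem mem_zariskiClosure_glOrbit_of_isDegeneration {d : V → ℕ} {X : Type x} [AddCommGroup X]
    [Module (PathAlgebra K V ⧸ I) X] {m : Rep I d} (h : IsDegeneration I X (RepModule m)) :
    ∃ m' : Rep I d, ModIso (PathAlgebra K V ⧸ I) (RepModule m) (RepModule m') ∧
      IsModuleIn (zariskiClosure (glOrbit m')) X := by
  obtain ⟨d', m', ⟨e⟩, h⟩ := h
  have hd : d' = d := funext fun i =>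
    ((hasDimVector_repModule m').2 i).symm.trans (((hasDimVector_repModule m).congr e).2 i)
  subst hd
  exact ⟨m', ⟨e⟩, h⟩

end Dimension

end QuiverRep

end

/-! ### The main theorem -/

open QuiverRep in
theorem proposition4p1 {K : Type u} [Field K] [IsAlgClosed K]
    {V : Type v} [Fintype V] [DecidableEq V] [Quiver.{w} V] [∀ a b : V, Finite (a ⟶ b)]
    (I : Ideal (PathAlgebra K V)) [I.IsTwoSided] (hI : IsAdmissible I)
    (hJ : ∀ r ∈ Ring.jacobson (PathAlgebra K V ⧸ I), ∀ s ∈ Ring.jacobson (PathAlgebra K V ⧸ I),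
      r * s = 0)
    (d : V → ℕ)
    (T : Type y) [AddCommGroup T] [Module (PathAlgebra K V ⧸ I) T]
    [Module.Finite (PathAlgebra K V ⧸ I) T] [IsSemisimpleModule (PathAlgebra K V ⧸ I) T]
    (hT : IsRealizable I d T) :
    -- (a) every module in the closure is a degeneration of a module with top `T`
    (∀ (X : Type x) [AddCommGroup X] [Module (PathAlgebra K V ⧸ I) X],
      IsModuleIn (zariskiClosure (RepTop I d T)) X →
        ∃ m ∈ RepTop I d T, IsDegeneration I X (RepModule m)) ∧
    -- (b) the modules with a top properly larger than `T`
    (∀ (X : Type x) [AddCommGroup X] [Module K X] [Module (PathAlgebra K V ⧸ I) X]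
      [IsScalarTower K (PathAlgebra K V ⧸ I) X],
      HasDimVector I d X →
      ProperlyEmbeds (PathAlgebra K V ⧸ I) T (ModTop (PathAlgebra K V ⧸ I) X) →
        ((∃ m ∈ RepTop I d T, IsDegeneration I X (RepModule m)) ↔
          ∃ X' U : Submodule (PathAlgebra K V ⧸ I) X, IsCompl X' U ∧
            ModIso (PathAlgebra K V ⧸ I) (ModTop (PathAlgebra K V ⧸ I) X') T ∧
            IsSemisimpleModule (PathAlgebra K V ⧸ I) U ∧ U ≠ ⊥) ∧
        (IsModuleIn (zariskiClosure (RepTop I d T)) X ↔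
          ∃ X' U : Submodule (PathAlgebra K V ⧸ I) X, IsCompl X' U ∧
            ModIso (PathAlgebra K V ⧸ I) (ModTop (PathAlgebra K V ⧸ I) X') T ∧
            IsSemisimpleModule (PathAlgebra K V ⧸ I) U ∧ U ≠ ⊥)) ∧
    -- the description of all modules in the closure
    (∀ (X : Type x) [AddCommGroup X] [Module K X] [Module (PathAlgebra K V ⧸ I) X]
      [IsScalarTower K (PathAlgebra K V ⧸ I) X],
      IsModuleIn (zariskiClosure (RepTop I d T)) X ↔
        HasDimVector I d X ∧
          ∃ X' U : Submodule (PathAlgebra K V ⧸ I) X, IsCompl X' U ∧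
            ModIso (PathAlgebra K V ⧸ I) (ModTop (PathAlgebra K V ⧸ I) X') T ∧
            IsSemisimpleModule (PathAlgebra K V ⧸ I) U) := by
  have _ := fun a b : V => Fintype.ofFinite (a ⟶ b)
  have closure_iff : ∀ z : Rep I d, z ∈ zariskiClosure (RepTop I d T) ↔
      HasSocleQuotient I (RepModule z) T := fun z =>
    ⟨hasSocleQuotient_of_mem_zariskiClosure hI hJ hT, fun h => by
      obtain ⟨m, hm, hz⟩ := exists_mem_zariskiClosure_glOrbit hI hJ hT h
      exact zariskiClosure_mono (glOrbit_subset_repTop hm) hz⟩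
  have part_a : ∀ (X : Type x) [AddCommGroup X] [Module (PathAlgebra K V ⧸ I) X],
      IsModuleIn (zariskiClosure (RepTop I d T)) X →
        ∃ m ∈ RepTop I d T, IsDegeneration I X (RepModule m) := by
    rintro X _ _ ⟨z, hz, e⟩
    obtain ⟨m, hm, hz'⟩ := exists_mem_zariskiClosure_glOrbit hI hJ hT ((closure_iff z).1 hz)
    exact ⟨m, hm, d, m, ⟨LinearEquiv.refl _ _⟩, z, hz', e⟩
  have degeneration_iff : ∀ (X : Type x) [AddCommGroup X] [Module (PathAlgebra K V ⧸ I) X],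
      (∃ m ∈ RepTop I d T, IsDegeneration I X (RepModule m)) ↔
        IsModuleIn (zariskiClosure (RepTop I d T)) X := by
    intro X _ _
    refine ⟨?_, part_a X⟩
    rintro ⟨m, ⟨f⟩, h⟩
    obtain ⟨m', ⟨e⟩, z, hz, e'⟩ := mem_zariskiClosure_glOrbit_of_isDegeneration h
    obtain ⟨g⟩ := modIso_top_of_equiv e
    exact ⟨z, zariskiClosure_mono (glOrbit_subset_repTop ⟨g.symm ≪≫ₗ f⟩) hz, e'⟩
  have part_c : ∀ (X : Type x) [AddCommGroup X] [Module K X] [Module (PathAlgebra K V ⧸ I) X]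
      [IsScalarTower K (PathAlgebra K V ⧸ I) X],
      IsModuleIn (zariskiClosure (RepTop I d T)) X ↔
        HasDimVector I d X ∧
          ∃ X' U : Submodule (PathAlgebra K V ⧸ I) X, IsCompl X' U ∧
            ModIso (PathAlgebra K V ⧸ I) (ModTop (PathAlgebra K V ⧸ I) X') T ∧
            IsSemisimpleModule (PathAlgebra K V ⧸ I) U := by
    intro X _ _ _ _
    rw [← hasSocleQuotient_iff hI hJ]
    constructor
    · rintro ⟨z, hz, ⟨e⟩⟩
      exact ⟨(hasDimVector_repModule z).congr e.symm, ((closure_iff z).1 hz).congr e.symm⟩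
    · rintro ⟨hX, h⟩
      obtain ⟨z, ⟨e⟩⟩ := exists_modIso_repModule hX
      exact ⟨z, (closure_iff z).2 (h.congr e), ⟨e⟩⟩
  refine ⟨part_a, fun X _ _ _ _ hX hTX => ?_, part_c⟩
  rw [degeneration_iff, and_self, part_c]
  constructor
  · rintro ⟨-, X', U, hc, ⟨f⟩, hU⟩
    refine ⟨X', U, hc, ⟨f⟩, hU, ?_⟩
    -- If `U = 0`, then `top X ≅ T`, so the proper embedding of `T` yields an injective endomorphism
    -- of the finite dimensional space `top X` which is not surjective.
    rintro rfl
    obtain ⟨j, hj, hj'⟩ := hTX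
    have := hX.1
    obtain ⟨g⟩ := modIso_top_of_equiv
      (LinearEquiv.ofTop X' (by simpa using hc.sup_eq_top) :
        X' ≃ₗ[PathAlgebra K V ⧸ I] X)
    refine hj' fun m => ?_
    obtain ⟨n, hn⟩ := (LinearMap.injective_iff_surjective (f :=
      ((j ∘ₗ (g.symm ≪≫ₗ f).toLinearMap).restrictScalars K))).1
        (hj.comp (g.symm ≪≫ₗ f).injective) m
    exact ⟨_, hn⟩
  · rintro ⟨X', U, hc, hf, hU, -⟩
    exact ⟨hX, X', U, hc, hf, hU⟩
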